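/- **Setting.** Let $m\in\mathbb N$ and $R>0$. Let $\langle u,v\rangle=-u_{m+1}v_{m+1}+\sum_{i\le m}u_iv_i$ on $\mathbb R^{m+1}$, and let $\mathbb H^m=\{u:\langle u,u\rangle=-1,\ u_{m+1}>0\}$ with the distance given by $\cosh d(u,v)=-\langle u,v\rangle$, the origin $\mathcal O=(0,\dots,0,1)$, and the volume $\mu_m$ whose image under the projection to the first $m$ coordinates has Lebesgue density $(1+|x|^2)^{-1/2}$. Let $\mathcal G=\mathrm{SO}(m,1)_0$ be the topological group of real $(m+1)\times(m+1)$ matrices of determinant $1$ that preserve the form and do not swap the two sheets of the hyperboloid (the orientation-preserving isometries of $\mathbb H^m$). In a space $V$ with distance $d$, an *$R$-packing* is a set $X$ whose distinct points are at distance at least $2R$; it is *relatively dense* if every closed ball of radius $2R$ contains a point of $X$; and $B_R(X)=\{y:\exists x\in X,\ d(x,y)\le R\}$. If $V$ carries a measure $\mu$ with $0<\mu(V)<\infty$, the density of $X$ is $D_R(X)=\mu(B_R(X))/\mu(V)$, and $D_R(V)$ is the supremum of $D_R(X)$ over all $R$-packings $X$ in $V$. Let $S_R$ be the space of relatively dense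 $R$-packings in $\mathbb H^m$ with the topology of Hausdorff convergence on bounded regions (the Chabauty–Fell topology, generated by the sets $\{X: X\cap U\ne\emptyset\}$, $U$ open, and $\{X: X\cap K=\emptyset\}$, $K$ compact). Let $\mathcal M_I(R)$ be the convex set of $\mathcal G$-invariant Borel probability measures on $S_R$. For $\mu\in\mathcal M_I(R)$ put $D(\mu)=\mu(\{X:\mathcal O\in B_R(X)\})$, and let $D_R(\mathbb H^m)$ be the supremum of $D(\mu)$ over the ergodic $\mu$, that is, over the extreme points $\mu$ of $\mathcal M_I(R)$. A *uniform torsion-free lattice* is a subgroup $\mathcal L\subseteq\mathcal G$ such that the quotient $M=\mathbb H^m/\mathcal L$ is compact and, for some $g>0$, $d(x,\gamma.x)\ge g$ for all $x\in\mathbb H^m$ and all $\gamma\in\mathcal L\setminus\{1\}$; its *girth* is the supremum of such $g$ (infinite if $\mathcal L$ is trivial). Let $\pi:\mathbb H^m\to M$ be the projection. Equip $M$ with the distance $d_M(x,y)=\inf\{d(u,v):\pi(u)=x,\ \pi(v)=y\}$ and the volume $\mu_M$ that is the image under $\pi$ of $\mu_m$ restricted to a fundamental domain of $\mathcal L$.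 **Lemma.** Let $\mathcal L\subseteq\mathcal G$ be a uniform torsion-free lattice of girth at least $8R$ and let $M=\mathbb H^m/\mathcal L$. Then $0<\mu_M(M)<\infty$ and $$D_R(\mathbb H^m)\ \ge\ D_R(M).$$ Moreover, for every relatively dense $R$-packing $Y$ in $(M,d_M)$, the lift $X=\pi^{-1}(Y)$ belongs to $S_R$, and there is a $\mathcal G$-invariant probability measure $\nu$ on $\mathcal G/\mathcal L$ such that the distribution $\mu_X$ of the random translate $\gamma.X$, where $\gamma\mathcal L$ is distributed according to $\nu$, belongs to $\mathcal M_I(R)$ and satisfies $D(\mu_X)=D_R(Y)$. -/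

import Mathlib

open MeasureTheory Set Matrix
open scoped ENNReal NNReal

noncomputable section

namespace BowenRadin

/-! ### Packings and their densities -/

/-- An `R`-packing for the distance function `d`: distinct points are at distance at least `2R`. -/
def IsPacking {V : Type*} (d : V → V → ℝ) (R : ℝ) (X : Set V) : Prop :=
  ∀ x ∈ X, ∀ y ∈ X, x ≠ y → 2 * R ≤ d x y

/-- Every closed ball of radius `2R` contains a point of `X`. -/
def IsRelDense {V : Type*} (d : V → V → ℝ) (R : ℝ) (X : Set V) : Prop :=
  ∀ x : V, ∃ y ∈ X, d x y ≤ 2 * R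

/-- The union `B_R(X)` of the closed `R`-balls around the points of `X`. -/
def ballUnion {V : Type*} (d : V → V → ℝ) (R : ℝ) (X : Set V) : Set V :=
  {y | ∃ x ∈ X, d x y ≤ R}

/-- The density `μ (B_R(X)) / μ(V)` of `X` (used for `0 < μ(V) < ∞`). -/
def density {V : Type*} [MeasurableSpace V] (d : V → V → ℝ) (μ : Measure V) (R : ℝ)
    (X : Set V) : ℝ≥0∞ :=
  μ (ballUnion d R X) / μ univ

/-- The `R`-packing density of a space of finite measure: the supremum of the densities of its
`R`-packings. -/
def packingDensity {V : Type*} [MeasurableSpace V] (d : V → V → ℝ) (μ : Measure V) (R : ℝ) :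
    ℝ≥0∞ :=
  ⨆ X ∈ {X : Set V | IsPacking d R X}, density d μ R X

/-! ### Hyperbolic space: the hyperboloid model -/

/-- The bilinear form `⟨u, v⟩ = -u_{m+1} v_{m+1} + ∑_{i ≤ m} u_i v_i` on `ℝ^{m+1}`. -/
def form {m : ℕ} (u v : Fin (m + 1) → ℝ) : ℝ :=
  -(u (Fin.last m) * v (Fin.last m)) + ∑ i : Fin m, u i.castSucc * v i.castSucc

/-- The upper sheet `{u | ⟨u, u⟩ = -1, u_{m+1} > 0}` of the hyperboloid. -/
def upperSheet (m : ℕ) : Set (Fin (m + 1) → ℝ) :=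
  {u | form u u = -1 ∧ 0 < u (Fin.last m)}

/-- The `m`-dimensional hyperbolic space. -/
@[ext]
structure Hyp (m : ℕ) where
  val : Fin (m + 1) → ℝ
  mem : val ∈ upperSheet m

/-- The topology (the one of the hyperbolic metric) is inherited from `ℝ^{m+1}`. -/
instance (m : ℕ) : TopologicalSpace (Hyp m) := TopologicalSpace.induced Hyp.val inferInstance
instance (m : ℕ) : MeasurableSpace (Hyp m) := borel (Hyp m)
instance (m : ℕ) : BorelSpace (Hyp m) := ⟨rfl⟩

/-- The hyperbolic distance: `d(x, y) ≥ 0` and `cosh d(x, y) = -⟨x, y⟩`. -/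
def hdist {m : ℕ} (x y : Hyp m) : ℝ := Real.arcosh (-form x.val y.val)

/-- The origin `(0, …, 0, 1)`. -/
def origin (m : ℕ) : Hyp m :=
  ⟨Fin.snoc (fun _ => 0) 1, by constructor <;> simp [form]⟩

/-- The inverse `x ↦ (x, √(1 + |x|²))` of the projection of the sheet to the first `m`
coordinates. -/
def chartInv {m : ℕ} (x : Fin m → ℝ) : Hyp m :=
  ⟨Fin.snoc x (√(1 + ∑ i, x i ^ 2)), by
    have h : 0 < 1 + ∑ i, x i ^ 2 := by positivity
    constructor
    · have h2 := Real.mul_self_sqrt h.le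
      simp only [form, Fin.snoc_last, Fin.snoc_castSucc, h2, ← pow_two]
      ring
    · simpa using Real.sqrt_pos.2 h⟩

/-- The hyperbolic volume: its image under the projection to the first `m` coordinates has density
`(1 + |x|²)^{-1/2}` with respect to Lebesgue measure. -/
def hvol (m : ℕ) : Measure (Hyp m) :=
  Measure.map chartInv
    ((volume : Measure (Fin m → ℝ)).withDensity
      fun x => ENNReal.ofReal ((1 + ∑ i, x i ^ 2) ^ (-(1 / 2) : ℝ)))

/-! ### The group of orientation-preserving isometries -/

lemma form_neg_neg {m : ℕ} (u : Fin (m + 1) → ℝ) : form (-u) (-u) = form u u := by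
  simp [form]

lemma form_self_lt {m : ℕ} {u : Fin (m + 1) → ℝ} (h : form u u = -1) : u (Fin.last m) ≠ 0 := by
  intro h0
  have : 0 ≤ ∑ i : Fin m, u i.castSucc * u i.castSucc :=
    Finset.sum_nonneg fun i _ => mul_self_nonneg _
  simp only [form, h0, mul_zero, neg_zero, zero_add] at h
  linarith

/-- `SO(m,1)₀`: the real `(m+1) × (m+1)` matrices of determinant one that leave the form invariant
and do not swap the two sheets, with the topology inherited from the space of matrices. -/
def G (m : ℕ) : Subgroup (SpecialLinearGroup (Fin (m + 1)) ℝ) where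
  carrier := {A | (∀ u v, form (A.toLin' u) (A.toLin' v) = form u v) ∧
    ∀ u ∈ upperSheet m, A.toLin' u ∈ upperSheet m}
  one_mem' := by simp
  mul_mem' := by
    rintro A B ⟨hA, hA'⟩ ⟨hB, hB'⟩
    refine ⟨fun u v => ?_, fun u hu => ?_⟩
    · simp only [map_mul, LinearEquiv.mul_apply]
      rw [hA, hB]
    · simp only [map_mul, LinearEquiv.mul_apply]
      exact hA' _ (hB' _ hu)
  inv_mem' := by
    rintro A ⟨hA, hA'⟩
    have key : ∀ u, A.toLin' (A⁻¹.toLin' u) = u := fun u => by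
      rw [← LinearEquiv.mul_apply, ← map_mul]
      simp
    have hinv : ∀ u v, form (A⁻¹.toLin' u) (A⁻¹.toLin' v) = form u v := fun u v => by
      rw [← hA, key, key]
    refine ⟨hinv, fun u hu => ?_⟩
    have h1 : form (A⁻¹.toLin' u) (A⁻¹.toLin' u) = -1 := by rw [hinv, hu.1]
    refine ⟨h1, ?_⟩
    by_contra hneg
    have hlt : (A⁻¹.toLin' u) (Fin.last m) < 0 :=
      lt_of_le_of_ne (not_lt.1 hneg) (form_self_lt h1)
    have h2 : -(A⁻¹.toLin' u) ∈ upperSheet m :=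
      ⟨by rw [form_neg_neg, h1], by simpa using hlt⟩
    have h3 := (hA' _ h2).2
    rw [map_neg, key] at h3
    have h4 := hu.2
    simp only [Pi.neg_apply] at h3
    linarith

instance (m : ℕ) : MeasurableSpace (G m) := borel (G m)
instance (m : ℕ) : BorelSpace (G m) := ⟨rfl⟩

/-- The action of the isometry group on hyperbolic space. -/
instance (m : ℕ) : MulAction (G m) (Hyp m) where
  smul A x := ⟨(A : SpecialLinearGroup (Fin (m + 1)) ℝ).toLin' x.val, A.2.2 _ x.mem⟩
  one_smul x := Hyp.ext (by
    change (1 : SpecialLinearGroup (Fin (m + 1)) ℝ).toLin' x.val = x.val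
    simp)
  mul_smul A B x := Hyp.ext (by
    change (A.1 * B.1).toLin' x.val = A.1.toLin' (B.1.toLin' x.val)
    rw [map_mul, LinearEquiv.mul_apply])

lemma hdist_smul {m : ℕ} (A : G m) (x y : Hyp m) : hdist (A • x) (A • y) = hdist x y := by
  change Real.arcosh (-form (A.1.toLin' x.val) (A.1.toLin' y.val)) = _
  rw [A.2.1]
  rfl

/-! ### The space of relatively dense packings and the Bowen–Radin density -/

/-- The space `S_R` of relatively dense `R`-packings of hyperbolic space. -/
@[ext]
structure S (m : ℕ) (R : ℝ) where
  pts : Set (Hyp m)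
  isPacking : IsPacking hdist R pts
  isRelDense : IsRelDense hdist R pts

/-- The topology of Hausdorff convergence on bounded regions (the Chabauty–Fell topology on closed
sets), generated by the sets of packings that hit a given open set and the sets of packings that
miss a given compact set. It makes `S_R` a compact metrizable space on which the isometries act
continuously. -/
instance (m : ℕ) (R : ℝ) : TopologicalSpace (S m R) :=
  TopologicalSpace.generateFrom
    ({E | ∃ U : Set (Hyp m), IsOpen U ∧ E = {X : S m R | (X.pts ∩ U).Nonempty}} ∪
      {E | ∃ K : Set (Hyp m), IsCompact K ∧ E = {X : S m R | X.pts ∩ K = ∅}})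

instance (m : ℕ) (R : ℝ) : MeasurableSpace (S m R) := borel (S m R)
instance (m : ℕ) (R : ℝ) : BorelSpace (S m R) := ⟨rfl⟩

/-- Isometries act on packings: `γ.X = {γ.x | x ∈ X}`. -/
instance (m : ℕ) (R : ℝ) : MulAction (G m) (S m R) where
  smul A X := ⟨(fun x => A • x) '' X.pts, by
      rintro _ ⟨x, hx, rfl⟩ _ ⟨y, hy, rfl⟩ hxy
      simp only [hdist_smul]
      exact X.isPacking x hx y hy fun h => hxy (by rw [h]), fun x => by
      obtain ⟨y, hy, hd⟩ := X.isRelDense (A⁻¹ • x)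
      refine ⟨A • y, ⟨y, hy, rfl⟩, ?_⟩
      rw [← hdist_smul A⁻¹, inv_smul_smul]
      exact hd⟩
  one_smul X := S.ext (by
    change (fun x => (1 : G m) • x) '' X.pts = X.pts
    simp)
  mul_smul A B X := S.ext (by
    change (fun x => (A * B) • x) '' X.pts = (fun x => A • x) '' ((fun x => B • x) '' X.pts)
    rw [image_image]
    simp only [mul_smul])

/-- The Borel probability measures on `S_R` that are invariant under the isometry group. -/
def invMeasures (m : ℕ) (R : ℝ) : Set (Measure (S m R)) :=
  {μ | IsProbabilityMeasure μ ∧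
    ∀ (γ : G m) (E : Set (S m R)), MeasurableSet E → μ ((fun X => γ • X) '' E) = μ E}

/-- The ergodic invariant measures, that is, the extreme points of the convex set of invariant
measures. -/
def ergMeasures (m : ℕ) (R : ℝ) : Set (Measure (S m R)) :=
  (invMeasures m R).extremePoints ℝ≥0

/-- The average density of `μ`: the integral of the indicator function of the event that the
closed `R`-balls around the packing cover the origin. -/
def avgDensity {m : ℕ} {R : ℝ} (μ : Measure (S m R)) : ℝ≥0∞ :=
  ∫⁻ X, Set.indicator {X : S m R | origin m ∈ ballUnion hdist R X.pts} 1 X ∂μ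

/-- The Bowen–Radin `R`-packing density `D_R(ℍ^m)`. -/
def hypDensity (m : ℕ) (R : ℝ) : ℝ≥0∞ :=
  ⨆ μ ∈ ergMeasures m R, avgDensity μ

/-! ### Lattices and their quotients -/

/-- The quotient `M = ℍ^m / L`, with the quotient topology and σ-algebra. -/
abbrev QuotSpace {m : ℕ} (L : Subgroup (G m)) : Type := MulAction.orbitRel.Quotient L (Hyp m)

/-- The projection `ℍ^m → M`. -/
def proj {m : ℕ} (L : Subgroup (G m)) (x : Hyp m) : QuotSpace L := Quotient.mk _ x

/-- Uniform torsion-free lattices. -/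
structure IsUniformLattice {m : ℕ} (L : Subgroup (G m)) : Prop where
  displacement : ∃ g : ℝ, 0 < g ∧ ∀ x : Hyp m, ∀ γ ∈ L, γ ≠ 1 → g ≤ hdist x (γ • x)
  compact : CompactSpace (QuotSpace L)

/-- The girth: the supremum of the `g` such that all non-identity elements of `L` move all points
by at least `g` (it is infinite for the trivial group). -/
def girth {m : ℕ} (L : Subgroup (G m)) : ℝ≥0∞ :=
  sSup {g : ℝ≥0∞ | ∀ x : Hyp m, ∀ γ ∈ L, γ ≠ 1 → g ≤ ENNReal.ofReal (hdist x (γ • x))}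

/-- The distance on `M`: the distance between the preimages in `ℍ^m`. -/
def qdist {m : ℕ} (L : Subgroup (G m)) (x y : QuotSpace L) : ℝ :=
  sInf {r : ℝ | ∃ u v : Hyp m, proj L u = x ∧ proj L v = y ∧ r = hdist u v}

open Classical in
/-- The volume on `M`: the image under the projection of the hyperbolic volume on a fundamental
domain of the action of `L` (all fundamental domains give the same measure). -/
def qvol {m : ℕ} (L : Subgroup (G m)) : Measure (QuotSpace L) :=
  if h : ∃ F : Set (Hyp m), IsFundamentalDomain L F (hvol m) then
    Measure.map (proj L) ((hvol m).restrict h.choose)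
  else 0

end BowenRadin

end

/-!
Every `R`-packing `Y` of `M = ℍ^m / L` extends to a maximal one (Zorn), and a maximal packing is
relatively dense. Since the girth is at least `8R`, the preimage `X` of a relatively dense packing
is a relatively dense packing of `ℍ^m` (`isPacking_preimage_of_le_girth`). It is invariant
under `L`, so that `γ L ↦ γ.X` is a well-defined map on `G / L`.

The measure `ν` on `G / L` is the distribution of `γ⁻¹ L`, where `γ` is Haar distributed on the set
of isometries that map the origin into a bounded fundamental domain `F` of `L`
(`cosetMeasure`). Its invariance needs the right invariance of the Haar measure. A right translation
multiplies the Haar measure by a scalar, but it maps the set above to another fundamental domain for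
the left action of `L` on `G`, which has the same measure, positive and finite; so the scalar is `1`
(`IsUniformLattice.isMulRightInvariant_haar`). In other words, a group with a uniform lattice is
unimodular.

The density of the random translate is the probability that `γ.𝒪 ∈ B_R(X)`, so `D(μ_X) = D_R(Y)`
says that the image of the Haar measure under `γ ↦ γ.𝒪` is proportional to the hyperbolic volume.
This follows from Fubini's theorem (`hvol_mul_haar_comm`), with the boosts as isometries that move
the origin to a given point, once the hyperbolic volume is known to be invariant. For the latter,
the Lebesgue measure of the truncated cone in `ℝ^{m+1}` over `E` is a constant multiple of the hyperbolic volume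
of `E` (`volume_cone`), and matrices of determinant one preserve Lebesgue measure.

Finally `μ_X` is ergodic because `G` acts transitively on `G / L`: if `μ_X` is a convex combination
of invariant measures, the density of one of them is almost invariant under each isometry, and
Fubini's theorem on `G × G` shows that it is almost constant on the orbit of `X`
(`map_cosetMeasure_mem_ergMeasures`).
-/

noncomputable section

namespace BowenRadin

/-! ### The form, reflections and boosts -/

lemma form_comm {m : ℕ} (u v : Fin (m + 1) → ℝ) : form u v = form v u := by
  simp only [form, mul_comm]

lemma form_add_left {m : ℕ} (u v w : Fin (m + 1) → ℝ) :
    form (u + v) w = form u w + form v w := by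
  simp only [form, Pi.add_apply, add_mul, Finset.sum_add_distrib]
  ring

lemma form_smul_left {m : ℕ} (c : ℝ) (u v : Fin (m + 1) → ℝ) :
    form (c • u) v = c * form u v := by
  simp only [form, Pi.smul_apply, smul_eq_mul, mul_add, Finset.mul_sum, mul_assoc]
  ring

lemma form_add_right {m : ℕ} (u v w : Fin (m + 1) → ℝ) :
    form u (v + w) = form u v + form u w := by
  rw [form_comm, form_add_left, form_comm v, form_comm w]

lemma form_smul_right {m : ℕ} (c : ℝ) (u v : Fin (m + 1) → ℝ) :
    form u (c • v) = c * form u v := by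
  rw [form_comm, form_smul_left, form_comm]

lemma form_sub_left {m : ℕ} (u v w : Fin (m + 1) → ℝ) :
    form (u - v) w = form u w - form v w := by
  rw [sub_eq_add_neg, ← neg_one_smul ℝ v, form_add_left, form_smul_left]
  ring

lemma form_sub_right {m : ℕ} (u v w : Fin (m + 1) → ℝ) :
    form u (v - w) = form u v - form u w := by
  rw [form_comm, form_sub_left, form_comm v, form_comm w]

lemma continuous_form {m : ℕ} :
    Continuous fun p : (Fin (m + 1) → ℝ) × (Fin (m + 1) → ℝ) => form p.1 p.2 := by
  unfold form
  fun_prop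

lemma form_origin_right {m : ℕ} (u : Fin (m + 1) → ℝ) :
    form u (origin m).val = -u (Fin.last m) := by
  simp [form, origin]

lemma origin_last (m : ℕ) : (origin m).val (Fin.last m) = 1 := by simp [origin]

lemma origin_castSucc {m : ℕ} (i : Fin m) : (origin m).val i.castSucc = 0 := by simp [origin]

namespace Hyp

variable {m : ℕ}

lemma form_self (x : Hyp m) : form x.val x.val = -1 := x.mem.1

lemma last_pos (x : Hyp m) : 0 < x.val (Fin.last m) := x.mem.2

lemma sum_sq (x : Hyp m) :
    ∑ i : Fin m, x.val i.castSucc ^ 2 = x.val (Fin.last m) ^ 2 - 1 := by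
  have := x.form_self
  simp only [form, ← pow_two] at this
  linarith

lemma one_le_last (x : Hyp m) : 1 ≤ x.val (Fin.last m) := by
  have h : 0 ≤ ∑ i : Fin m, x.val i.castSucc ^ 2 := Finset.sum_nonneg fun i _ => sq_nonneg _
  rw [x.sum_sq] at h
  nlinarith [x.last_pos]

/-- The Cauchy-Schwarz inequality for the spatial parts. -/
lemma abs_form_add_le (x y : Hyp m) :
    |form x.val y.val + x.val (Fin.last m) * y.val (Fin.last m)| ≤
      √(x.val (Fin.last m) ^ 2 - 1) * √(y.val (Fin.last m) ^ 2 - 1) := by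
  rw [← Real.sqrt_mul' _ (by nlinarith [y.one_le_last])]
  apply Real.abs_le_sqrt
  have h := Finset.sum_mul_sq_le_sq_mul_sq Finset.univ (fun i : Fin m => x.val i.castSucc)
    (fun i : Fin m => y.val i.castSucc)
  rw [x.sum_sq, y.sum_sq] at h
  simpa [form] using h

lemma one_le_neg_form (x y : Hyp m) : 1 ≤ -form x.val y.val := by
  have h := (abs_le.1 (x.abs_form_add_le y)).2
  have hx := x.one_le_last
  have hy := y.one_le_last
  set s := x.val (Fin.last m)
  set t := y.val (Fin.last m)
  have : √(s ^ 2 - 1) * √(t ^ 2 - 1) ≤ s * t - 1 := by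
    rw [← Real.sqrt_mul' _ (by nlinarith)]
    apply Real.sqrt_le_iff.2 ⟨by nlinarith, by nlinarith [sq_nonneg (s - t)]⟩
  linarith

end Hyp

/-- Flipping the sign of the last coordinate turns the dot product into the form. -/
def flipLast {m : ℕ} (u : Fin (m + 1) → ℝ) : Fin (m + 1) → ℝ :=
  Fin.snoc (fun i => u i.castSucc) (-u (Fin.last m))

lemma flipLast_dotProduct {m : ℕ} (u v : Fin (m + 1) → ℝ) : flipLast u ⬝ᵥ v = form u v := by
  simp only [dotProduct, Fin.sum_univ_castSucc, flipLast, Fin.snoc_castSucc, Fin.snoc_last, form]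
  ring

/-- The reflection in the hyperplane orthogonal to `w`, for the form. -/
def reflMatrix {m : ℕ} (w : Fin (m + 1) → ℝ) : Matrix (Fin (m + 1)) (Fin (m + 1)) ℝ :=
  1 - (2 / form w w) • vecMulVec w (flipLast w)

lemma reflMatrix_mulVec {m : ℕ} (w u : Fin (m + 1) → ℝ) :
    reflMatrix w *ᵥ u = u - (2 * form w u / form w w) • w := by
  rw [reflMatrix, sub_mulVec, one_mulVec, smul_mulVec, vecMulVec_mulVec, flipLast_dotProduct,
    op_smul_eq_smul, smul_smul]
  congr 2
  ring

lemma form_reflMatrix_mulVec {m : ℕ} {w : Fin (m + 1) → ℝ} (hw : form w w ≠ 0)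
    (u v : Fin (m + 1) → ℝ) : form (reflMatrix w *ᵥ u) (reflMatrix w *ᵥ v) = form u v := by
  simp only [reflMatrix_mulVec, form_sub_left, form_sub_right, form_smul_left, form_smul_right]
  rw [form_comm u w]
  field_simp
  ring

lemma det_reflMatrix {m : ℕ} {w : Fin (m + 1) → ℝ} (hw : form w w ≠ 0) :
    (reflMatrix w).det = -1 := by
  have h := det_one_add_replicateCol_mul_replicateRow (ι := Unit)
    (-(2 / form w w) • w) (flipLast w)
  rw [dotProduct_smul, flipLast_dotProduct, smul_eq_mul, neg_mul, div_mul_cancel₀ _ hw] at h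
  have h2 : reflMatrix w = 1 + replicateCol Unit (-(2 / form w w) • w) *
      replicateRow Unit (flipLast w) := by
    ext i j
    simp [reflMatrix, vecMulVec_apply, Matrix.mul_apply, sub_eq_add_neg, mul_assoc]
  rw [h2, h]
  norm_num

/-- A form-preserving map of the hyperboloid that sends the origin to the upper sheet preserves
the upper sheet. -/
lemma mem_upperSheet_of_form {m : ℕ} {f : (Fin (m + 1) → ℝ) → (Fin (m + 1) → ℝ)}
    (hf : ∀ u v, form (f u) (f v) = form u v) {x : Hyp m}
    (hx : f x.val ∈ upperSheet m) : ∀ u ∈ upperSheet m, f u ∈ upperSheet m := by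
  intro u hu
  have h1 : form (f u) (f u) = -1 := by rw [hf, hu.1]
  refine ⟨h1, ?_⟩
  by_contra hneg
  have hlt : (f u) (Fin.last m) < 0 := lt_of_le_of_ne (not_lt.1 hneg) (form_self_lt h1)
  have h2 : -(f u) ∈ upperSheet m := ⟨by rw [form_neg_neg, h1], by simpa using hlt⟩
  have h3 := Hyp.one_le_neg_form ⟨_, hx⟩ ⟨_, h2⟩
  have h4 := Hyp.one_le_neg_form x ⟨u, hu⟩
  simp only [← neg_one_smul ℝ (f u), form_smul_right, hf] at h3
  simp only at h4
  linarith

lemma form_add_origin {m : ℕ} (x : Hyp m) :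
    form (x.val + (origin m).val) (x.val + (origin m).val) = -2 * (x.val (Fin.last m) + 1) := by
  simp only [form_add_left, form_add_right, form_origin_right, x.form_self,
    form_comm (origin m).val, Pi.add_apply, origin_last]
  ring

lemma form_add_origin_ne {m : ℕ} (x : Hyp m) :
    form (x.val + (origin m).val) (x.val + (origin m).val) ≠ 0 := by
  rw [form_add_origin]
  nlinarith [x.last_pos]

lemma form_origin_ne (m : ℕ) : form (origin m).val (origin m).val ≠ 0 := by
  rw [(origin m).form_self]
  norm_num

/-- The matrix of the boost, a product of the reflections in the timelike vectors `x + 𝒪`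
and `𝒪`. -/
def boostMatrix {m : ℕ} (x : Hyp m) : Matrix (Fin (m + 1)) (Fin (m + 1)) ℝ :=
  reflMatrix (x.val + (origin m).val) * reflMatrix (origin m).val

lemma reflMatrix_origin_mulVec {m : ℕ} (u : Fin (m + 1) → ℝ) :
    reflMatrix (origin m).val *ᵥ u = flipLast u := by
  rw [reflMatrix_mulVec, form_comm, form_origin_right, (origin m).form_self]
  ext i
  refine Fin.lastCases ?_ (fun i => ?_) i
  · simp only [Pi.sub_apply, Pi.smul_apply, origin_last, flipLast, Fin.snoc_last, smul_eq_mul]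
    ring
  · simp [origin_castSucc, flipLast]

lemma boostMatrix_mulVec_origin {m : ℕ} (x : Hyp m) :
    boostMatrix x *ᵥ (origin m).val = x.val := by
  have h0 : reflMatrix (origin m).val *ᵥ (origin m).val = -(origin m).val := by
    rw [reflMatrix_mulVec, mul_div_assoc, div_self (form_origin_ne m), mul_one, two_smul]
    simp
  have hx := x.last_pos
  rw [boostMatrix, ← mulVec_mulVec, h0, mulVec_neg, reflMatrix_mulVec, form_add_origin,
    form_origin_right, Pi.add_apply, origin_last]
  have : 2 * -(x.val (Fin.last m) + 1) / (-2 * (x.val (Fin.last m) + 1)) = 1 := by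
    field_simp
  rw [this, one_smul]
  simp

/-- The boost: an orientation-preserving isometry that maps the origin to `x`, and whose inverse
maps it to the mirror image of `x` in the origin. -/
def boost {m : ℕ} (x : Hyp m) : G m :=
  ⟨⟨boostMatrix x, by
    rw [boostMatrix, det_mul, det_reflMatrix (form_add_origin_ne x),
      det_reflMatrix (form_origin_ne m)]
    norm_num⟩, by
    have hf : ∀ u v, form (boostMatrix x *ᵥ u) (boostMatrix x *ᵥ v) = form u v := fun u v => by
      simp only [boostMatrix, ← mulVec_mulVec]
      rw [form_reflMatrix_mulVec (form_add_origin_ne x), form_reflMatrix_mulVec (form_origin_ne m)]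
    refine ⟨fun u v => hf u v, fun u hu => ?_⟩
    refine mem_upperSheet_of_form hf (x := origin m) ?_ u hu
    rw [boostMatrix_mulVec_origin]
    exact x.mem⟩

variable {m : ℕ}

lemma smul_val (A : G m) (x : Hyp m) : (A • x).val = A.1.1 *ᵥ x.val := rfl

lemma form_smul_smul (A : G m) (x y : Hyp m) :
    form (A • x).val (A • y).val = form x.val y.val := A.2.1 _ _

lemma boost_smul_origin (x : Hyp m) : boost x • origin m = x :=
  Hyp.ext (boostMatrix_mulVec_origin x)

/-- The point reflection `(y, t) ↦ (-y, t)` of hyperbolic space at the origin. -/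
def pointRefl (x : Hyp m) : Hyp m :=
  ⟨-flipLast x.val, by
    have h : form (flipLast x.val) (flipLast x.val) = form x.val x.val := by
      simp [form, flipLast]
    refine ⟨by rw [form_neg_neg, h, x.form_self], ?_⟩
    simpa [flipLast] using x.last_pos⟩

lemma boost_inv_smul_origin (x : Hyp m) : (boost x)⁻¹ • origin m = pointRefl x := by
  rw [inv_smul_eq_iff]
  refine Hyp.ext ?_
  have hx := x.last_pos
  have h0 : flipLast (flipLast x.val) = x.val := by
    ext i
    refine Fin.lastCases ?_ (fun i => ?_) i <;> simp [flipLast]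
  rw [smul_val]
  change _ = boostMatrix x *ᵥ -flipLast x.val
  rw [boostMatrix, ← mulVec_mulVec, mulVec_neg, reflMatrix_origin_mulVec, h0, mulVec_neg,
    reflMatrix_mulVec, form_add_origin, form_add_left, x.form_self, form_comm (origin m).val,
    form_origin_right]
  have : 2 * (-1 + -x.val (Fin.last m)) / (-2 * (x.val (Fin.last m) + 1)) = 1 := by
    field_simp
    ring
  rw [this, one_smul]
  simp

/-! ### Hyperbolic space as a metric space -/

lemma hdist_nonneg (x y : Hyp m) : 0 ≤ hdist x y := Real.arcosh_nonneg (x.one_le_neg_form y)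

lemma cosh_hdist (x y : Hyp m) : Real.cosh (hdist x y) = -form x.val y.val :=
  Real.cosh_arcosh (x.one_le_neg_form y)

lemma hdist_self (x : Hyp m) : hdist x x = 0 := by
  simp [hdist, x.form_self, Real.arcosh_zero]

lemma hdist_comm (x y : Hyp m) : hdist x y = hdist y x := by
  rw [hdist, form_comm, hdist]

lemma hdist_origin (x : Hyp m) : hdist x (origin m) = Real.arcosh (x.val (Fin.last m)) := by
  rw [hdist, form_origin_right, neg_neg]

lemma hdist_triangle (x y z : Hyp m) : hdist x z ≤ hdist x y + hdist y z := by
  have key : ∀ x z : Hyp m, hdist x z ≤ hdist x (origin m) + hdist (origin m) z := by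
    intro x z
    have h0 := add_nonneg (hdist_nonneg x (origin m)) (hdist_nonneg (origin m) z)
    rw [← abs_of_nonneg (hdist_nonneg x z), ← abs_of_nonneg h0, ← Real.cosh_le_cosh,
      cosh_hdist, Real.cosh_add, hdist_comm (origin m), hdist_origin, hdist_origin,
      Real.cosh_arcosh x.one_le_last, Real.cosh_arcosh z.one_le_last,
      Real.sinh_arcosh x.one_le_last, Real.sinh_arcosh z.one_le_last]
    linarith [(abs_le.1 (x.abs_form_add_le z)).1]
  have h := key ((boost y)⁻¹ • x) ((boost y)⁻¹ • z)
  have e : origin m = (boost y)⁻¹ • y := by rw [eq_inv_smul_iff, boost_smul_origin]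
  rwa [e, hdist_smul, hdist_smul, hdist_smul] at h

lemma continuous_val : Continuous (Hyp.val : Hyp m → _) := continuous_induced_dom

lemma isEmbedding_val : Topology.IsEmbedding (Hyp.val : Hyp m → _) :=
  ⟨⟨rfl⟩, fun _ _ h => Hyp.ext h⟩

lemma isClosedEmbedding_val : Topology.IsClosedEmbedding (Hyp.val : Hyp m → _) := by
  refine ⟨isEmbedding_val, ?_⟩
  have : range (Hyp.val : Hyp m → _) =
      {u | form u u = -1} ∩ {u | 1 ≤ u (Fin.last m)} := by
    ext u
    constructor
    · rintro ⟨x, rfl⟩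
      exact ⟨x.form_self, x.one_le_last⟩
    · rintro ⟨h1, h2⟩
      exact ⟨⟨u, h1, lt_of_lt_of_le one_pos h2⟩, rfl⟩
  rw [this]
  refine IsClosed.inter (isClosed_eq (continuous_form.comp
    (continuous_id.prodMk continuous_id)) continuous_const)
    (isClosed_le continuous_const (continuous_apply _))

instance : T2Space (Hyp m) := isEmbedding_val.t2Space
instance : SecondCountableTopology (Hyp m) := isEmbedding_val.secondCountableTopology

lemma continuous_hdist : Continuous fun p : Hyp m × Hyp m => hdist p.1 p.2 := by
  have h : Continuous fun p : Hyp m × Hyp m => -form p.1.val p.2.val :=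
    (continuous_form.comp (f := fun p : Hyp m × Hyp m => (p.1.val, p.2.val))
      ((continuous_val.comp continuous_fst).prodMk (continuous_val.comp continuous_snd))).neg
  exact Real.continuousOn_arcosh.comp_continuous h fun p => p.1.one_le_neg_form p.2

lemma isOpen_hball (x : Hyp m) (r : ℝ) : IsOpen {y | hdist x y < r} :=
  isOpen_lt (continuous_hdist.comp (by fun_prop : Continuous fun y => (x, y))) continuous_const

lemma isClosed_hclosedBall (x : Hyp m) (r : ℝ) : IsClosed {y | hdist x y ≤ r} :=
  isClosed_le (continuous_hdist.comp (by fun_prop : Continuous fun y => (x, y))) continuous_const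

lemma abs_val_le_last (x : Hyp m) (i : Fin (m + 1)) : |x.val i| ≤ x.val (Fin.last m) := by
  refine Fin.lastCases ?_ (fun i => ?_) i
  · rw [abs_of_pos x.last_pos]
  · refine abs_le_of_sq_le_sq ?_ x.last_pos.le
    have h := Finset.single_le_sum (f := fun i : Fin m => x.val i.castSucc ^ 2)
      (fun i _ => sq_nonneg _) (Finset.mem_univ i)
    simp only [x.sum_sq] at h
    linarith

lemma isCompact_last_le (c : ℝ) : IsCompact {x : Hyp m | x.val (Fin.last m) ≤ c} := by
  have h : IsCompact ((Hyp.val : Hyp m → _) ⁻¹' (Set.pi univ fun _ => Icc (-c) c)) :=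
    isClosedEmbedding_val.isCompact_preimage (isCompact_univ_pi fun _ => isCompact_Icc)
  refine h.of_isClosed_subset (isClosed_le ((continuous_apply _).comp continuous_val)
    continuous_const) fun x hx i _ => ?_
  exact abs_le.1 ((abs_val_le_last x i).trans hx)

lemma last_le_iff (x : Hyp m) (r : ℝ) (hr : 0 ≤ r) :
    x.val (Fin.last m) ≤ Real.cosh r ↔ hdist (origin m) x ≤ r := by
  rw [hdist_comm, hdist_origin, ← Real.arcosh_le_arcosh x.last_pos (Real.cosh_pos r),
    Real.arcosh_cosh hr]

lemma isCompact_hclosedBall (x : Hyp m) (r : ℝ) : IsCompact {y | hdist x y ≤ r} := by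
  refine (isCompact_last_le (Real.cosh (hdist (origin m) x + |r|))).of_isClosed_subset
    (isClosed_hclosedBall x r) fun y hy => ?_
  have h0 := hdist_nonneg (origin m) x
  refine (last_le_iff y _ (by positivity)).2 ?_
  have hy' : hdist x y ≤ r := hy
  linarith [hdist_triangle (origin m) x y, le_abs_self r]

/-! ### The isometry group as a locally compact group -/

/-- The inclusion of the isometry group into the space of matrices. -/
def toMat (A : G m) : Matrix (Fin (m + 1)) (Fin (m + 1)) ℝ := A.1.1

lemma isEmbedding_toMat : Topology.IsEmbedding (toMat : G m → _) :=
  Topology.IsEmbedding.subtypeVal.comp Topology.IsEmbedding.subtypeVal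

lemma continuous_toMat : Continuous (toMat : G m → _) := isEmbedding_toMat.continuous

instance : ContinuousSMul (G m) (Hyp m) := by
  refine ⟨continuous_induced_rng.2 ?_⟩
  exact (continuous_toMat.comp continuous_fst).matrix_mulVec (continuous_val.comp continuous_snd)

lemma isClosedEmbedding_toMat : Topology.IsClosedEmbedding (toMat : G m → _) := by
  refine ⟨isEmbedding_toMat, ?_⟩
  -- the condition on the sheets is closed because the last coordinate is at least `1` there
  have : range (toMat : G m → _) = {A | A.det = 1} ∩
      ((⋂ u : Fin (m + 1) → ℝ, ⋂ v : Fin (m + 1) → ℝ,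
        {A | form (A *ᵥ u) (A *ᵥ v) = form u v}) ∩
        {A | 1 ≤ (A *ᵥ (origin m).val) (Fin.last m)}) := by
    ext A
    simp only [mem_inter_iff, mem_iInter, mem_ofPred_eq]
    constructor
    · rintro ⟨B, rfl⟩
      exact ⟨B.1.2, B.2.1, (B • origin m).one_le_last⟩
    · rintro ⟨h1, h2, h3⟩
      refine ⟨⟨⟨A, h1⟩, h2, fun u hu => mem_upperSheet_of_form h2 (x := origin m) ?_ u hu⟩, rfl⟩
      exact ⟨by rw [h2]; exact (origin m).form_self, lt_of_lt_of_le one_pos h3⟩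
  rw [this]
  refine (isClosed_eq continuous_id.matrix_det continuous_const).inter
    (IsClosed.inter (isClosed_iInter fun u => isClosed_iInter fun v => ?_) ?_)
  · exact isClosed_eq (continuous_form.comp
      ((continuous_id.matrix_mulVec continuous_const).prodMk
        (continuous_id.matrix_mulVec continuous_const))) continuous_const
  · exact isClosed_le continuous_const ((continuous_apply (Fin.last m)).comp
      (continuous_id.matrix_mulVec (continuous_const (y := (origin m).val))))

instance : SecondCountableTopology (Matrix (Fin (m + 1)) (Fin (m + 1)) ℝ) :=
  inferInstanceAs (SecondCountableTopology (Fin (m + 1) → Fin (m + 1) → ℝ))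

instance : SecondCountableTopology (G m) := isEmbedding_toMat.secondCountableTopology

instance : LocallyCompactSpace (Matrix (Fin (m + 1)) (Fin (m + 1)) ℝ) :=
  inferInstanceAs (LocallyCompactSpace (Fin (m + 1) → Fin (m + 1) → ℝ))

instance : LocallyCompactSpace (G m) := isClosedEmbedding_toMat.locallyCompactSpace

lemma form_single_castSucc (j : Fin m) (u : Fin (m + 1) → ℝ) :
    form (Pi.single j.castSucc 1) u = u j.castSucc := by
  simp [form, Pi.single_apply, Fin.castSucc_inj, (Fin.castSucc_lt_last _).ne']

lemma toMat_mulVec_single (A : G m) (i j : Fin (m + 1)) :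
    (toMat A *ᵥ Pi.single j 1) i = toMat A i j := by
  simp

/-- The entries of an isometry are controlled by the displacement of the origin. -/
lemma abs_toMat_le (A : G m) (i j : Fin (m + 1)) :
    |toMat A i j| ≤ (A • origin m).val (Fin.last m) := by
  have hlast : (A⁻¹ • origin m).val (Fin.last m) = (A • origin m).val (Fin.last m) := by
    have h := form_smul_smul A (A⁻¹ • origin m) (origin m)
    rw [smul_inv_smul, form_comm, form_origin_right, form_origin_right] at h
    linarith
  have horig : (origin m).val = Pi.single (Fin.last m) 1 := by
    ext k
    refine Fin.lastCases ?_ (fun k => ?_) k <;> simp [origin]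
  refine Fin.lastCases ?_ (fun j => ?_) j
  · have h := abs_val_le_last (A • origin m) i
    have e : ∀ k, (A • origin m).val k = toMat A k (Fin.last m) := fun k => by
      rw [← toMat_mulVec_single A k, ← horig]
      rfl
    rwa [e i] at h
  -- the last entry of column `j` is a spatial coordinate of `A⁻¹ 𝒪`
  have hs : toMat A (Fin.last m) j.castSucc = -(A⁻¹ • origin m).val j.castSucc := by
    have h := A.2.1 (Pi.single j.castSucc 1) (A⁻¹ • origin m).val
    change form (toMat A *ᵥ Pi.single j.castSucc 1) (A • (A⁻¹ • origin m)).val = _ at h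
    rw [smul_inv_smul, form_origin_right, toMat_mulVec_single, form_single_castSucc] at h
    linarith
  have hs2 : toMat A (Fin.last m) j.castSucc ^ 2 ≤ (A • origin m).val (Fin.last m) ^ 2 - 1 := by
    rw [hs, neg_sq, ← hlast, ← Hyp.sum_sq]
    exact Finset.single_le_sum (f := fun i : Fin m => (A⁻¹ • origin m).val i.castSucc ^ 2)
      (fun i _ => sq_nonneg _) (Finset.mem_univ j)
  have hcol : ∑ k : Fin m, toMat A k.castSucc j.castSucc ^ 2 =
      1 + toMat A (Fin.last m) j.castSucc ^ 2 := by
    have h := A.2.1 (Pi.single j.castSucc 1) (Pi.single j.castSucc 1)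
    change form (toMat A *ᵥ Pi.single j.castSucc 1) (toMat A *ᵥ Pi.single j.castSucc 1) = _ at h
    rw [form_single_castSucc] at h
    simp only [form, toMat_mulVec_single, Pi.single_eq_same, ← pow_two] at h
    linarith
  refine abs_le_of_sq_le_sq ?_ (A • origin m).last_pos.le
  refine Fin.lastCases ?_ (fun i => ?_) i
  · linarith
  · have h := Finset.single_le_sum (f := fun k : Fin m => toMat A k.castSucc j.castSucc ^ 2)
      (fun i _ => sq_nonneg _) (Finset.mem_univ i)
    simp only [hcol] at h
    linarith

/-- The orbit map `γ ↦ γ.𝒪` is proper. -/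
lemma isCompact_preimage_orbit {K : Set (Hyp m)} (hK : IsCompact K) :
    IsCompact {A : G m | A • origin m ∈ K} := by
  have hcont : Continuous fun A : G m => A • origin m := continuous_id.smul continuous_const
  obtain ⟨c, hc⟩ := (hK.image ((continuous_apply (Fin.last m)).comp continuous_val)).bddAbove
  have h : IsCompact ((toMat : G m → _) ⁻¹' (Set.pi univ fun _ => Set.pi univ fun _ =>
      Icc (-c) c)) :=
    isClosedEmbedding_toMat.isCompact_preimage
      (isCompact_univ_pi fun _ => isCompact_univ_pi fun _ => isCompact_Icc)
  refine h.of_isClosed_subset (hK.isClosed.preimage hcont) fun A hA i _ j _ => ?_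
  exact abs_le.1 ((abs_toMat_le A i j).trans (hc ⟨_, hA, rfl⟩))

/-! ### The invariance of the hyperbolic volume -/

lemma continuous_chartInv : Continuous (chartInv : (Fin m → ℝ) → Hyp m) := by
  refine continuous_induced_rng.2 (continuous_pi fun i => ?_)
  refine Fin.lastCases ?_ (fun i => ?_) i
  · simp only [Function.comp_apply, chartInv, Fin.snoc_last]
    fun_prop
  · simp only [Function.comp_apply, chartInv, Fin.snoc_castSucc]
    fun_prop

lemma chartInv_castSucc (x : Fin m → ℝ) (i : Fin m) : (chartInv x).val i.castSucc = x i := by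
  simp [chartInv]

lemma chartInv_last (x : Fin m → ℝ) :
    (chartInv x).val (Fin.last m) = √(1 + ∑ i, x i ^ 2) := by
  simp [chartInv]

lemma chartInv_init (x : Hyp m) : chartInv (fun i => x.val i.castSucc) = x := by
  refine Hyp.ext (funext fun i => ?_)
  refine Fin.lastCases ?_ (fun i => ?_) i
  · rw [chartInv_last, x.sum_sq, add_sub_cancel, Real.sqrt_sq x.last_pos.le]
  · rw [chartInv_castSucc]

/-- The density of the hyperbolic volume in the chart. -/
def hdens (x : Fin m → ℝ) : ℝ≥0∞ := ENNReal.ofReal ((1 + ∑ i, x i ^ 2) ^ (-(1 / 2) : ℝ))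

lemma hdens_eq (x : Fin m → ℝ) : hdens x = ENNReal.ofReal (1 / √(1 + ∑ i, x i ^ 2)) := by
  rw [hdens, Real.rpow_neg (by positivity), ← Real.sqrt_eq_rpow, one_div]

lemma measurable_hdens : Measurable (hdens : (Fin m → ℝ) → ℝ≥0∞) := by
  have : (hdens : (Fin m → ℝ) → ℝ≥0∞) =
      fun x => ENNReal.ofReal (1 / √(1 + ∑ i, x i ^ 2)) := funext hdens_eq
  rw [this]
  fun_prop

lemma hvol_apply {E : Set (Hyp m)} (hE : MeasurableSet E) :
    hvol m E = ∫⁻ x, (chartInv ⁻¹' E).indicator hdens x := by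
  rw [hvol, Measure.map_apply continuous_chartInv.measurable hE,
    withDensity_apply _ (continuous_chartInv.measurable hE),
    lintegral_indicator (continuous_chartInv.measurable hE)]
  rfl

/-- The truncated open cone in `ℝ^{m+1}` over a subset of the hyperboloid. -/
def cone (E : Set (Hyp m)) : Set (Fin (m + 1) → ℝ) :=
  {w | ∃ t ∈ Ioo (0 : ℝ) 1, ∃ x ∈ E, w = t • x.val}

lemma measurableSet_cone {E : Set (Hyp m)} (hE : MeasurableSet E) : MeasurableSet (cone E) := by
  have h1 : MeasurableSet ((Hyp.val : Hyp m → _) '' E) :=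
    isClosedEmbedding_val.measurableEmbedding.measurableSet_image.2 hE
  have hform : Continuous fun w : Fin (m + 1) → ℝ => form w w :=
    continuous_form.comp (continuous_id.prodMk continuous_id)
  have h2 : cone E = {w | form w w < 0} ∩ {w | -1 < form w w} ∩
      (fun w => (√(-form w w))⁻¹ • w) ⁻¹' (Hyp.val '' E) := by
    ext w
    constructor
    · rintro ⟨t, ⟨ht0, ht1⟩, x, hx, rfl⟩
      have hf : form (t • x.val) (t • x.val) = -t ^ 2 := by
        rw [form_smul_left, form_smul_right, x.form_self]
        ring
      refine ⟨⟨?_, ?_⟩, x, hx, ?_⟩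
      · rw [mem_ofPred_eq, hf]
        nlinarith
      · rw [mem_ofPred_eq, hf]
        nlinarith
      · simp only [hf, neg_neg, Real.sqrt_sq ht0.le, smul_smul, inv_mul_cancel₀ ht0.ne', one_smul]
    · rintro ⟨⟨h1, h2⟩, x, hx, hxw⟩
      simp only [mem_ofPred_eq] at h1 h2
      have hpos : 0 < √(-form w w) := Real.sqrt_pos.2 (by linarith)
      refine ⟨√(-form w w), ⟨hpos, ?_⟩, x, hx, ?_⟩
      · rw [Real.sqrt_lt' one_pos]
        linarith
      · rw [hxw, smul_smul, mul_inv_cancel₀ hpos.ne', one_smul]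
  rw [h2]
  refine ((isOpen_lt hform continuous_const).measurableSet.inter
    (isOpen_lt continuous_const hform).measurableSet).inter ?_
  have hm := hform.measurable
  have h3 : Measurable fun w : Fin (m + 1) → ℝ => (√(-form w w))⁻¹ • w := by fun_prop
  exact h3 h1

lemma snoc_mem_cone {E : Set (Hyp m)} (y : Fin m → ℝ) (s : ℝ) :
    (Fin.snoc y s : Fin (m + 1) → ℝ) ∈ cone E ↔
      ∃ t ∈ Ioo (0 : ℝ) 1 ∩ {t | chartInv (t⁻¹ • y) ∈ E}, √(t ^ 2 + ∑ i, y i ^ 2) = s := by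
  have key : ∀ t : ℝ, 0 < t → t * √(1 + ∑ i, (t⁻¹ • y) i ^ 2) = √(t ^ 2 + ∑ i, y i ^ 2) := by
    intro t ht
    rw [← Real.sqrt_sq ht.le, ← Real.sqrt_mul (sq_nonneg t), Real.sqrt_sq ht.le]
    simp only [Pi.smul_apply, smul_eq_mul, mul_pow, ← Finset.mul_sum]
    field_simp
  constructor
  · rintro ⟨t, ht, x, hx, h⟩
    have h1 : ∀ i, y i = t * x.val i.castSucc := fun i => by
      simpa using congrFun h i.castSucc
    have h2 : s = t * x.val (Fin.last m) := by simpa using congrFun h (Fin.last m)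
    have h3 : t⁻¹ • y = fun i => x.val i.castSucc := by
      ext i
      rw [Pi.smul_apply, h1, smul_eq_mul, inv_mul_cancel_left₀ ht.1.ne']
    refine ⟨t, ⟨ht, ?_⟩, ?_⟩
    · rw [mem_ofPred_eq, h3, chartInv_init]
      exact hx
    · rw [← key t ht.1, h2, ← chartInv_last, h3, chartInv_init]
  · rintro ⟨t, ⟨ht, hE⟩, rfl⟩
    refine ⟨t, ht, _, hE, ?_⟩
    ext i
    refine Fin.lastCases ?_ (fun i => ?_) i
    · rw [Fin.snoc_last, Pi.smul_apply, chartInv_last, smul_eq_mul, key t ht.1]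
    · rw [Fin.snoc_castSucc, Pi.smul_apply, chartInv_castSucc, Pi.smul_apply, smul_eq_mul,
        smul_eq_mul, mul_inv_cancel_left₀ ht.1.ne']

/-- The fibres of the cone over the spatial coordinates `y`, by the substitution
`s = √(t² + |y|²)`. -/
lemma volume_fiber_cone {E : Set (Hyp m)} (hE : MeasurableSet E) (y : Fin m → ℝ) :
    volume {s : ℝ | (Fin.snoc y s : Fin (m + 1) → ℝ) ∈ cone E} =
      ∫⁻ t in Ioo (0 : ℝ) 1, (chartInv ⁻¹' E).indicator hdens (t⁻¹ • y) := by
  have hq : 0 ≤ ∑ i, y i ^ 2 := Finset.sum_nonneg fun i _ => sq_nonneg _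
  have hT : MeasurableSet {t : ℝ | chartInv (t⁻¹ • y) ∈ E} := by
    have : Measurable fun t : ℝ => chartInv (t⁻¹ • y) :=
      continuous_chartInv.measurable.comp (by fun_prop)
    exact this hE
  have himg : {s : ℝ | (Fin.snoc y s : Fin (m + 1) → ℝ) ∈ cone E} =
      (fun t => √(t ^ 2 + ∑ i, y i ^ 2)) '' (Ioo (0 : ℝ) 1 ∩ {t | chartInv (t⁻¹ • y) ∈ E}) := by
    ext s
    exact snoc_mem_cone y s
  have hder : ∀ t ∈ Ioo (0 : ℝ) 1 ∩ {t | chartInv (t⁻¹ • y) ∈ E},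
      HasDerivWithinAt (fun t => √(t ^ 2 + ∑ i, y i ^ 2)) (t / √(t ^ 2 + ∑ i, y i ^ 2))
        (Ioo (0 : ℝ) 1 ∩ {t | chartInv (t⁻¹ • y) ∈ E}) t := by
    intro t ht
    have ht0 : 0 < t := ht.1.1
    have h := (((hasDerivAt_id t).pow 2).add_const (∑ i, y i ^ 2)).sqrt (by
      change t ^ 2 + ∑ i, y i ^ 2 ≠ 0
      positivity)
    refine (h.congr_deriv ?_).hasDerivWithinAt
    simp only [id, Nat.cast_ofNat, Nat.add_one_sub_one, pow_one, mul_one, Pi.pow_apply]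
    rw [mul_div_mul_left _ _ two_ne_zero]
  have hinj : InjOn (fun t => √(t ^ 2 + ∑ i, y i ^ 2))
      (Ioo (0 : ℝ) 1 ∩ {t | chartInv (t⁻¹ • y) ∈ E}) := by
    intro t ht s hs h
    have h' := (Real.sqrt_inj (by positivity) (by positivity)).1 h
    exact (sq_eq_sq₀ ht.1.1.le hs.1.1.le).1 (by linarith)
  have h := lintegral_image_eq_lintegral_abs_deriv_mul (measurableSet_Ioo.inter hT) hder hinj 1
  rw [himg, ← setLIntegral_one]
  simp only [Pi.one_apply, mul_one] at h
  rw [h, inter_comm, ← setLIntegral_indicator hT]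
  refine setLIntegral_congr_fun measurableSet_Ioo fun t ht => ?_
  by_cases hm : chartInv (t⁻¹ • y) ∈ E
  · rw [indicator_of_mem (show t ∈ {t : ℝ | chartInv (t⁻¹ • y) ∈ E} from hm),
      indicator_of_mem (show t⁻¹ • y ∈ chartInv ⁻¹' E from hm), hdens_eq,
      abs_of_nonneg (div_nonneg ht.1.le (Real.sqrt_nonneg _))]
    congr 1
    have ht0 : 0 < t := ht.1
    have : t ^ 2 + ∑ i, y i ^ 2 = t ^ 2 * (1 + ∑ i, (t⁻¹ • y) i ^ 2) := by
      simp only [Pi.smul_apply, smul_eq_mul, mul_pow, ← Finset.mul_sum]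
      field_simp
    rw [this, Real.sqrt_mul (sq_nonneg t), Real.sqrt_sq ht0.le]
    field_simp
  · rw [indicator_of_notMem (show t ∉ {t : ℝ | chartInv (t⁻¹ • y) ∈ E} from hm),
      indicator_of_notMem (show t⁻¹ • y ∉ chartInv ⁻¹' E from hm)]

/-- The Lebesgue volume of a cone is proportional to the hyperbolic volume of its base. -/
lemma volume_cone {E : Set (Hyp m)} (hE : MeasurableSet E) :
    volume (cone E) = (∫⁻ t in Ioo (0 : ℝ) 1, ENNReal.ofReal (t ^ m)) * hvol m E := by
  have hH : Measurable ((chartInv ⁻¹' E).indicator hdens : (Fin m → ℝ) → ℝ≥0∞) :=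
    measurable_hdens.indicator (continuous_chartInv.measurable hE)
  have hmp := (volume_preserving_piFinSuccAbove (fun _ : Fin (m + 1) => ℝ) (Fin.last m)).symm
  have hpre : (MeasurableEquiv.piFinSuccAbove (fun _ : Fin (m + 1) => ℝ) (Fin.last m)).symm ⁻¹'
      cone E = {p : ℝ × (Fin m → ℝ) | (Fin.snoc p.2 p.1 : Fin (m + 1) → ℝ) ∈ cone E} := by
    ext p
    have : (MeasurableEquiv.piFinSuccAbove (fun _ : Fin (m + 1) => ℝ) (Fin.last m)).symm p =
        Fin.snoc p.2 p.1 := by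
      change Fin.insertNth (α := fun _ => ℝ) (Fin.last m) p.1 p.2 = _
      exact Fin.insertNth_last' p.1 p.2
    rw [mem_preimage, this]
    rfl
  have hms : MeasurableSet {p : ℝ × (Fin m → ℝ) | (Fin.snoc p.2 p.1 : Fin (m + 1) → ℝ) ∈ cone E} := by
    rw [← hpre]
    exact hmp.measurable (measurableSet_cone hE)
  rw [← hmp.measure_preimage (measurableSet_cone hE).nullMeasurableSet, hpre,
    Measure.volume_eq_prod, Measure.prod_apply_symm hms]
  calc ∫⁻ y, volume {s : ℝ | (Fin.snoc y s : Fin (m + 1) → ℝ) ∈ cone E}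
      = ∫⁻ y : Fin m → ℝ, ∫⁻ t in Ioo (0 : ℝ) 1, (chartInv ⁻¹' E).indicator hdens (t⁻¹ • y) :=
        lintegral_congr fun y => volume_fiber_cone hE y
    _ = ∫⁻ t in Ioo (0 : ℝ) 1, ∫⁻ y : Fin m → ℝ, (chartInv ⁻¹' E).indicator hdens (t⁻¹ • y) := by
        refine lintegral_lintegral_swap (Measurable.aemeasurable ?_)
        exact hH.comp (by fun_prop)
    _ = ∫⁻ t in Ioo (0 : ℝ) 1, ENNReal.ofReal (t ^ m) * hvol m E := by
        refine setLIntegral_congr_fun measurableSet_Ioo fun t ht => ?_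
        have ht0 : 0 < t := ht.1
        have h1 := lintegral_map (μ := volume) hH (measurable_const_smul t⁻¹ : Measurable
          fun y : Fin m → ℝ => t⁻¹ • y)
        rw [Measure.map_addHaar_smul volume (inv_ne_zero ht0.ne'), lintegral_smul_measure] at h1
        change ∫⁻ y : Fin m → ℝ, (chartInv ⁻¹' E).indicator hdens (t⁻¹ • y) = _
        rw [← h1, hvol_apply hE, Module.finrank_fin_fun, inv_pow, inv_inv,
          abs_of_pos (pow_pos ht0 m), smul_eq_mul]
    _ = _ := lintegral_mul_const _ (by fun_prop)

lemma smul_mem_cone_iff (A : G m) (E : Set (Hyp m)) (w : Fin (m + 1) → ℝ) :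
    toMat A *ᵥ w ∈ cone E ↔ w ∈ cone ((fun x => A • x) ⁻¹' E) := by
  constructor
  · rintro ⟨t, ht, x, hx, h⟩
    refine ⟨t, ht, A⁻¹ • x, by simpa using hx, ?_⟩
    have h1 : A.1.toLin' w = A.1.toLin' (t • (A⁻¹ • x).val) := by
      rw [map_smul]
      change toMat A *ᵥ w = t • (A • (A⁻¹ • x)).val
      rw [h, smul_inv_smul]
    exact A.1.toLin'.injective h1
  · rintro ⟨t, ht, x, hx, rfl⟩
    refine ⟨t, ht, A • x, hx, ?_⟩
    rw [mulVec_smul]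
    rfl

instance : SMulInvariantMeasure (G m) (Hyp m) (hvol m) := by
  refine ⟨fun A E hE => ?_⟩
  have hE' : MeasurableSet ((fun x => A • x) ⁻¹' E) := (measurable_const_smul A) hE
  have hdet : (toMat A).det = 1 := A.1.2
  have hvolume : volume (cone ((fun x => A • x) ⁻¹' E)) = volume (cone E) := by
    have h1 := Real.map_matrix_volume_pi_eq_smul_volume_pi (M := toMat A) (by simp [hdet])
    rw [hdet, inv_one, abs_one, ENNReal.ofReal_one, one_smul] at h1
    have hcont : Measurable (Matrix.toLin' (toMat A)) :=
      (LinearMap.continuous_of_finiteDimensional _).measurable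
    conv_rhs => rw [← h1, Measure.map_apply hcont (measurableSet_cone hE)]
    congr 1
    ext w
    exact (smul_mem_cone_iff A E w).symm
  rw [volume_cone hE', volume_cone hE] at hvolume
  refine (ENNReal.mul_right_inj ?_ ?_).1 hvolume
  · refine ((setLIntegral_pos_iff (by fun_prop)).2 ?_).ne'
    have : Function.support (fun t : ℝ => ENNReal.ofReal (t ^ m)) ∩ Ioo 0 1 = Ioo 0 1 := by
      refine inter_eq_right.2 fun t ht => ?_
      simpa using pow_pos ht.1 m
    rw [this]
    simp
  · refine (lt_of_le_of_lt (setLIntegral_mono measurable_const (g := fun _ => 1) fun t ht => ?_)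
      (by simp)).ne
    exact ENNReal.ofReal_le_one.2 (pow_le_one₀ ht.1.le ht.2.le)

lemma continuous_pointRefl : Continuous (pointRefl : Hyp m → Hyp m) := by
  refine continuous_induced_rng.2 (continuous_pi fun i => ?_)
  refine Fin.lastCases ?_ (fun i => ?_) i
  · simp only [Function.comp_apply, pointRefl, flipLast, Pi.neg_apply, Fin.snoc_last, neg_neg]
    exact (continuous_apply _).comp continuous_val
  · simp only [Function.comp_apply, pointRefl, flipLast, Pi.neg_apply, Fin.snoc_castSucc]
    exact ((continuous_apply i.castSucc).comp continuous_val).neg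

lemma pointRefl_chartInv (x : Fin m → ℝ) : pointRefl (chartInv x) = chartInv (-x) := by
  refine Hyp.ext (funext fun i => ?_)
  refine Fin.lastCases ?_ (fun i => ?_) i <;> simp [pointRefl, flipLast, chartInv]

lemma measurePreserving_pointRefl : MeasurePreserving pointRefl (hvol m) (hvol m) := by
  refine ⟨continuous_pointRefl.measurable, Measure.ext fun E hE => ?_⟩
  rw [Measure.map_apply continuous_pointRefl.measurable hE,
    hvol_apply (continuous_pointRefl.measurable hE), hvol_apply hE,
    ← lintegral_neg_eq_self]
  refine lintegral_congr fun x => ?_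
  have h : hdens (-x) = hdens x := by simp [hdens]
  by_cases hx : chartInv x ∈ E
  · rw [indicator_of_mem, indicator_of_mem (show x ∈ chartInv ⁻¹' E from hx), h]
    rwa [mem_preimage, mem_preimage, pointRefl_chartInv, neg_neg]
  · rw [indicator_of_notMem, indicator_of_notMem (show x ∉ chartInv ⁻¹' E from hx)]
    rwa [mem_preimage, mem_preimage, pointRefl_chartInv, neg_neg]

instance : IsFiniteMeasureOnCompacts (hvol m) := by
  refine ⟨fun K hK => ?_⟩
  obtain ⟨c, hc⟩ := (hK.image ((continuous_apply (Fin.last m)).comp continuous_val)).bddAbove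
  rw [hvol_apply hK.measurableSet]
  have hI : MeasurableSet (Icc (fun _ => -c) (fun _ => c) : Set (Fin m → ℝ)) := measurableSet_Icc
  refine lt_of_le_of_lt (b := ∫⁻ x : Fin m → ℝ, (Icc (fun _ => -c) (fun _ => c)).indicator 1 x)
    (lintegral_mono fun x => ?_) ?_
  · by_cases hx : chartInv x ∈ K
    · have hx' : ∀ i, |x i| ≤ c := fun i => by
        rw [← chartInv_castSucc x i]
        exact (abs_val_le_last _ _).trans (hc ⟨_, hx, rfl⟩)
      rw [indicator_of_mem (show x ∈ chartInv ⁻¹' K from hx), indicator_of_mem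
        (show x ∈ Icc (fun _ => -c) (fun _ => c) from
          ⟨fun i => (abs_le.1 (hx' i)).1, fun i => (abs_le.1 (hx' i)).2⟩), hdens_eq]
      refine ENNReal.ofReal_le_one.2 ?_
      rw [div_le_one₀ (by positivity), Real.one_le_sqrt]
      linarith [Finset.sum_nonneg fun i (_ : i ∈ Finset.univ) => sq_nonneg (x i)]
    · rw [indicator_of_notMem (show x ∉ chartInv ⁻¹' K from hx)]
      exact zero_le
  · rw [lintegral_indicator_one hI]
    exact isCompact_Icc.measure_lt_top

lemma hvol_univ_pos : 0 < hvol m univ := by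
  rw [hvol_apply MeasurableSet.univ, preimage_univ, indicator_univ,
    lintegral_pos_iff_support measurable_hdens]
  have : Function.support (hdens : (Fin m → ℝ) → ℝ≥0∞) = univ := by
    refine eq_univ_of_forall fun x => ?_
    rw [Function.mem_support, hdens_eq]
    have : 0 < 1 / √(1 + ∑ i, x i ^ 2) := by positivity
    simpa using this
  rw [this]
  exact isOpen_univ.measure_pos _ univ_nonempty

instance : LocallyCompactSpace (Hyp m) := isClosedEmbedding_val.locallyCompactSpace

/-! ### Separated sets and lattices -/

lemma IsPacking.eq_of_hdist_lt {X : Set (Hyp m)} {R : ℝ} (hX : IsPacking hdist R X)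
    {x y : Hyp m} (hx : x ∈ X) (hy : y ∈ X) (h : hdist x y < 2 * R) : x = y := by
  by_contra hne
  exact absurd (hX x hx y hy hne) (not_le.2 h)

lemma IsPacking.isClosed {X : Set (Hyp m)} {R : ℝ} (hR : 0 < R) (hX : IsPacking hdist R X) :
    IsClosed X := by
  refine isOpen_compl_iff.1 (isOpen_iff_mem_nhds.2 fun x hx => ?_)
  have hball : {y | hdist x y < R} ∈ nhds x :=
    (isOpen_hball x R).mem_nhds (by simpa [hdist_self] using hR)
  by_cases hne : ∃ y ∈ X, hdist x y < R
  · obtain ⟨y, hy, hxy⟩ := hne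
    have hxy' : x ≠ y := fun h => hx (h ▸ hy)
    filter_upwards [hball, isOpen_compl_singleton.mem_nhds hxy'] with z hz hzy hzX
    refine hzy (hX.eq_of_hdist_lt hzX hy ?_)
    have hz' : hdist x z < R := hz
    linarith [hdist_triangle z x y, hdist_comm z x]
  · filter_upwards [hball] with z hz hzX
    exact hne ⟨z, hzX, hz⟩

lemma IsPacking.countable {X : Set (Hyp m)} {R : ℝ} (hR : 0 < R) (hX : IsPacking hdist R X) :
    X.Countable := by
  refine PairwiseDisjoint.countable_of_isOpen (s := fun x : Hyp m => {y | hdist x y < R}) ?_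
    (fun x _ => isOpen_hball x R) fun x _ => ⟨x, by simpa [hdist_self] using hR⟩
  intro x hx y hy hxy
  refine disjoint_left.2 fun z hz hz' => hxy (hX.eq_of_hdist_lt hx hy ?_)
  have h1 : hdist x z < R := hz
  have h2 : hdist y z < R := hz'
  linarith [hdist_triangle x z y, hdist_comm z y]

lemma ballUnion_eq_biUnion {V : Type*} (d : V → V → ℝ) (R : ℝ) (X : Set V) :
    ballUnion d R X = ⋃ x ∈ X, {y | d x y ≤ R} := by
  ext y
  simp [ballUnion]

lemma IsPacking.measurableSet_ballUnion {X : Set (Hyp m)} {R : ℝ} (hR : 0 < R)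
    (hX : IsPacking hdist R X) : MeasurableSet (ballUnion hdist R X) := by
  rw [ballUnion_eq_biUnion]
  exact MeasurableSet.biUnion (hX.countable hR) fun x _ => (isClosed_hclosedBall x R).measurableSet

variable {L : Subgroup (G m)}

lemma proj_eq_iff {x y : Hyp m} : proj L x = proj L y ↔ ∃ γ : L, γ • y = x := by
  rw [proj, proj, Quotient.eq, MulAction.orbitRel_apply]
  rfl

lemma proj_smul (γ : L) (x : Hyp m) : proj L (γ • x) = proj L x := proj_eq_iff.2 ⟨γ, rfl⟩

lemma proj_surjective : Function.Surjective (proj L) := Quotient.mk_surjective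

lemma isOpenMap_proj : IsOpenMap (proj L) := isOpenMap_quotient_mk'_mul

lemma measurable_proj : Measurable (proj L) := measurable_quot_mk

lemma hdist_smul_left (γ : L) (x y : Hyp m) : hdist (γ • x) y = hdist x (γ⁻¹ • y) := by
  rw [← hdist_smul (γ : G m) x (γ⁻¹ • y)]
  change _ = hdist (γ • x) (γ • γ⁻¹ • y)
  rw [smul_inv_smul]

namespace IsUniformLattice

lemma exists_separation (hL : IsUniformLattice L) :
    ∃ g : ℝ, 0 < g ∧ ∀ (x : Hyp m) (γ : L), hdist x (γ • x) < g → γ = 1 := by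
  obtain ⟨g, hg, h⟩ := hL.displacement
  refine ⟨g, hg, fun x γ hlt => ?_⟩
  by_contra hne
  exact absurd (h x γ γ.2 fun h1 => hne (Subtype.ext h1)) (not_le.2 hlt)

lemma eq_of_smul_eq (hL : IsUniformLattice L) {x : Hyp m} {γ δ : L} (h : γ • x = δ • x) :
    γ = δ := by
  obtain ⟨g, hg, hsep⟩ := hL.exists_separation
  have h1 := hsep x (δ⁻¹ * γ) (by rw [mul_smul, h, inv_smul_smul, hdist_self]; exact hg)
  exact (inv_mul_eq_one.1 h1).symm

lemma exists_isPacking_orbit (hL : IsUniformLattice L) :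
    ∃ r : ℝ, 0 < r ∧ ∀ x : Hyp m, IsPacking hdist r (range fun γ : L => γ • x) := by
  obtain ⟨g, hg, hsep⟩ := hL.exists_separation
  refine ⟨g / 2, half_pos hg, fun x => ?_⟩
  rintro _ ⟨γ, rfl⟩ _ ⟨δ, rfl⟩ hne
  by_contra hlt
  rw [not_le, mul_div_cancel₀ _ two_ne_zero, hdist_smul_left, ← mul_smul] at hlt
  have h := inv_mul_eq_one.1 (hsep x _ hlt)
  exact hne (by simp only [h])

lemma countable (hL : IsUniformLattice L) : Countable L := by
  obtain ⟨r, hr, h⟩ := hL.exists_isPacking_orbit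
  have := ((h (origin m)).countable hr).to_subtype
  exact (rangeFactorization_injective.2 fun γ δ h => hL.eq_of_smul_eq h :
    Function.Injective (rangeFactorization fun γ : L => γ • origin m)).countable

/-- A bounded strict fundamental domain: from finitely many small balls whose translates cover the
space, remove what is covered by the translates of the earlier balls. -/
lemma exists_fundamentalDomain (hL : IsUniformLattice L) :
    ∃ F : Set (Hyp m), MeasurableSet F ∧ (∃ K, IsCompact K ∧ F ⊆ K) ∧
      ∀ x : Hyp m, ∃! γ : L, γ • x ∈ F := by
  obtain ⟨g, hg, hsep⟩ := hL.exists_separation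
  have := hL.compact
  set r := g / 2 with hr
  obtain ⟨t, ht⟩ := isCompact_univ.elim_finite_subcover
    (fun c : Hyp m => proj L '' {y | hdist c y < r})
    (fun c => isOpenMap_proj _ (isOpen_hball c r)) (fun q _ => by
      obtain ⟨x, rfl⟩ := proj_surjective q
      exact mem_iUnion.2 ⟨x, x, by simpa [hdist_self, hr] using hg, rfl⟩)
  obtain ⟨n, c, hcov⟩ : ∃ (n : ℕ) (c : Fin n → Hyp m),
      ∀ x : Hyp m, ∃ i, ∃ γ : L, hdist (c i) (γ • x) < r := by
    refine ⟨t.card, fun i => (t.equivFin.symm i).1, fun x => ?_⟩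
    obtain ⟨c, hc, y, hy, hyx⟩ := by simpa using ht (mem_univ (proj L x))
    obtain ⟨γ, rfl⟩ := proj_eq_iff.1 hyx
    exact ⟨t.equivFin ⟨c, hc⟩, γ, by simpa using hy⟩
  set U : Fin n → Set (Hyp m) := fun i => ⋃ γ : L, {x | hdist (c i) (γ • x) < r} with hU
  have hmemU : ∀ i x, x ∈ U i ↔ ∃ γ : L, hdist (c i) (γ • x) < r := fun i x => by simp [hU]
  have hUinv : ∀ i x (γ : L), γ • x ∈ U i ↔ x ∈ U i := by
    intro i x γ
    rw [hmemU, hmemU]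
    constructor
    · rintro ⟨δ, hδ⟩
      exact ⟨δ * γ, by rwa [mul_smul]⟩
    · rintro ⟨δ, hδ⟩
      exact ⟨δ * γ⁻¹, by rwa [mul_smul, inv_smul_smul]⟩
  have hUopen : ∀ i, IsOpen (U i) := fun i => isOpen_iUnion fun γ =>
    (isOpen_hball (c i) r).preimage (continuous_const_smul γ)
  refine ⟨⋃ i, ({x | hdist (c i) x < r} \ ⋃ j ∈ Iio i, U j), ?_,
    ⟨⋃ i, {x | hdist (c i) x ≤ r}, isCompact_iUnion fun i => isCompact_hclosedBall (c i) r, ?_⟩,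
    fun x => ?_⟩
  · exact MeasurableSet.iUnion fun i => (isOpen_hball (c i) r).measurableSet.diff
      (isOpen_biUnion fun j _ => hUopen j).measurableSet
  · exact iUnion_mono fun i x hx =>
      le_of_lt (show hdist (c i) x < r from hx.1)
  · have hmem : ∀ γ : L, γ • x ∈ ⋃ i, ({x | hdist (c i) x < r} \ ⋃ j ∈ Iio i, U j) ↔
        ∃ i, hdist (c i) (γ • x) < r ∧ ∀ j < i, x ∉ U j := by
      intro γ
      simp only [mem_iUnion, mem_sdiff, mem_ofPred_eq, mem_Iio, hUinv, not_exists, exists_prop,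
        not_and]
    obtain ⟨i, hi, hmin⟩ := (wellFounded_lt : WellFounded ((· < ·) : Fin n → Fin n → Prop)).has_min
      {i | x ∈ U i} (by
        obtain ⟨i, hi⟩ := hcov x
        exact ⟨i, (hmemU i x).2 hi⟩)
    obtain ⟨γ, hγ⟩ := (hmemU i x).1 hi
    refine ⟨γ, (hmem γ).2 ⟨i, hγ, fun j hj hxj => hmin j hxj hj⟩, fun δ hδ => ?_⟩
    obtain ⟨k, hk, hkmin⟩ := (hmem δ).1 hδ
    have h1 : ¬ i < k := fun h => hkmin i h hi
    have h2 : ¬ k < i := hmin k ((hmemU k x).2 ⟨δ, hk⟩)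
    obtain rfl : i = k := le_antisymm (not_lt.1 h2) (not_lt.1 h1)
    -- two translates of `x` in one ball of radius `r` are closer than the displacement of `L`
    have h3 : hdist (γ • x) ((δ * γ⁻¹) • (γ • x)) < g := by
      rw [mul_smul, inv_smul_smul]
      linarith [hdist_triangle (γ • x) (c i) (δ • x), hdist_comm (γ • x) (c i)]
    exact mul_inv_eq_one.1 (hsep _ _ h3)

/-- A measurable set that contains exactly one point of each orbit computes the volume of the
quotient. -/
lemma qvol_apply (hL : IsUniformLattice L) {F : Set (Hyp m)} (hF : MeasurableSet F)
    (hFu : ∀ x : Hyp m, ∃! γ : L, γ • x ∈ F) {E : Set (QuotSpace L)} (hE : MeasurableSet E) :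
    qvol L E = hvol m (proj L ⁻¹' E ∩ F) := by
  have := hL.countable
  have hFd : IsFundamentalDomain L F (hvol m) := IsFundamentalDomain.mk' hF.nullMeasurableSet hFu
  have hex : ∃ F : Set (Hyp m), IsFundamentalDomain L F (hvol m) := ⟨F, hFd⟩
  rw [qvol, dif_pos hex, Measure.map_apply measurable_proj hE,
    Measure.restrict_apply (measurable_proj hE)]
  refine hex.choose_spec.measure_set_eq hFd (measurable_proj hE) fun γ => ?_
  ext x
  simp only [mem_preimage, proj_smul]

lemma hvol_fundamentalDomain_pos (hL : IsUniformLattice L) {F : Set (Hyp m)}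
    (hF : MeasurableSet F) (hFu : ∀ x : Hyp m, ∃! γ : L, γ • x ∈ F) : 0 < hvol m F := by
  have := hL.countable
  have hFd : IsFundamentalDomain L F (hvol m) := IsFundamentalDomain.mk' hF.nullMeasurableSet hFu
  refine pos_iff_ne_zero.2 fun h0 => hvol_univ_pos.ne' (hFd.measure_zero_of_invariant univ
    (fun γ => smul_set_univ) ?_)
  rwa [univ_inter]

/-! ### The distance on the quotient -/

lemma exists_qdist_eq (hL : IsUniformLattice L) (x y : Hyp m) :
    ∃ γ : L, qdist L (proj L x) (proj L y) = hdist x (γ • y) := by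
  obtain ⟨r, hr, hpack⟩ := hL.exists_isPacking_orbit
  have hcont : Continuous fun z => hdist x z :=
    continuous_hdist.comp (by fun_prop : Continuous fun z => (x, z))
  have hK : IsCompact ({z | hdist x z ≤ hdist x y} ∩ range fun γ : L => γ • y) :=
    (isCompact_hclosedBall x _).inter_right ((hpack y).isClosed hr)
  obtain ⟨_, ⟨-, γ, rfl⟩, hmin⟩ := hK.exists_isMinOn
    ⟨y, le_refl (hdist x y), 1, one_smul L y⟩ hcont.continuousOn
  have hmin' : ∀ δ : L, hdist x (γ • y) ≤ hdist x (δ • y) := by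
    intro δ
    rcases le_total (hdist x (δ • y)) (hdist x y) with h | h
    · exact hmin ⟨h, δ, rfl⟩
    · refine le_trans ?_ h
      exact hmin (a := y) ⟨show hdist x y ≤ hdist x y from le_rfl, 1, one_smul L y⟩
  refine ⟨γ, IsLeast.csInf_eq ⟨⟨x, γ • y, rfl, proj_smul γ y, rfl⟩, ?_⟩⟩
  rintro _ ⟨u, v, hu, hv, rfl⟩
  obtain ⟨α, rfl⟩ := proj_eq_iff.1 hu
  obtain ⟨β, rfl⟩ := proj_eq_iff.1 hv
  rw [hdist_smul_left, ← mul_smul]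
  exact hmin' _

end IsUniformLattice

lemma qdist_le_hdist (x y : Hyp m) : qdist L (proj L x) (proj L y) ≤ hdist x y := by
  refine csInf_le ⟨0, ?_⟩ ⟨x, y, rfl, rfl, rfl⟩
  rintro _ ⟨u, v, -, -, rfl⟩
  exact hdist_nonneg u v

lemma qdist_comm (p q : QuotSpace L) : qdist L p q = qdist L q p := by
  rw [qdist, qdist]
  congr 1
  ext r
  constructor <;> rintro ⟨u, v, hu, hv, rfl⟩ <;> exact ⟨v, u, hv, hu, hdist_comm u v⟩

namespace IsUniformLattice

lemma exists_hdist_le_iff (hL : IsUniformLattice L) (Y : Set (QuotSpace L)) (x : Hyp m) (r : ℝ) :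
    (∃ y ∈ proj L ⁻¹' Y, hdist x y ≤ r) ↔ ∃ q ∈ Y, qdist L (proj L x) q ≤ r := by
  constructor
  · rintro ⟨y, hy, h⟩
    exact ⟨proj L y, hy, (qdist_le_hdist x y).trans h⟩
  · rintro ⟨q, hq, h⟩
    obtain ⟨y, rfl⟩ := proj_surjective q
    obtain ⟨γ, hγ⟩ := hL.exists_qdist_eq x y
    exact ⟨γ • y, by rwa [mem_preimage, proj_smul], hγ ▸ h⟩

lemma ballUnion_preimage (hL : IsUniformLattice L) (Y : Set (QuotSpace L)) (R : ℝ) :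
    ballUnion hdist R (proj L ⁻¹' Y) = proj L ⁻¹' ballUnion (qdist L) R Y := by
  ext x
  have h := hL.exists_hdist_le_iff Y x R
  simp only [hdist_comm x, qdist_comm (proj L x)] at h
  exact h

lemma isRelDense_preimage (hL : IsUniformLattice L) {Y : Set (QuotSpace L)} {R : ℝ}
    (hY : IsRelDense (qdist L) R Y) : IsRelDense hdist R (proj L ⁻¹' Y) :=
  fun x => (hL.exists_hdist_le_iff Y x (2 * R)).2 (hY (proj L x))

end IsUniformLattice

/-- A girth of at least `8R` makes the lift of a packing a packing. -/
lemma isPacking_preimage_of_le_girth {R : ℝ} (hR : 0 < R) (hg : ENNReal.ofReal (8 * R) ≤ girth L)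
    {Y : Set (QuotSpace L)} (hY : IsPacking (qdist L) R Y) :
    IsPacking hdist R (proj L ⁻¹' Y) := by
  intro x hx y hy hxy
  by_cases h : proj L y = proj L x
  · obtain ⟨γ, rfl⟩ := proj_eq_iff.1 h
    have hne : (γ : G m) ≠ 1 := fun h1 => hxy (by
      rw [show γ = 1 from Subtype.ext h1, one_smul])
    have h2 : ENNReal.ofReal (8 * R) ≤ ENNReal.ofReal (hdist x (γ • x)) :=
      hg.trans (sSup_le fun g hg' => hg' x γ γ.2 hne)
    have h3 := (ENNReal.ofReal_le_ofReal_iff (hdist_nonneg _ _)).1 h2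
    linarith
  · exact (hY _ hx _ hy (Ne.symm h)).trans (qdist_le_hdist x y)

/-! ### Haar measure and the hyperbolic volume -/

/-- The set of isometries that map the origin into `E`. -/
def orbitPreimage (E : Set (Hyp m)) : Set (G m) := {γ | γ • origin m ∈ E}

lemma continuous_smul_origin : Continuous fun γ : G m => γ • origin m :=
  continuous_id.smul continuous_const

lemma measurableSet_orbitPreimage {E : Set (Hyp m)} (hE : MeasurableSet E) :
    MeasurableSet (orbitPreimage E) :=
  continuous_smul_origin.measurable hE

lemma haar_orbitPreimage_lt_top {E K : Set (Hyp m)} (hK : IsCompact K) (hE : E ⊆ K) :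
    Measure.haar (orbitPreimage E) < ⊤ :=
  lt_of_le_of_lt (measure_mono fun _ hγ => hE hγ) (isCompact_preimage_orbit hK).measure_lt_top

variable {F : Set (Hyp m)}

lemma existsUnique_smul_mem_orbitPreimage (hFu : ∀ x : Hyp m, ∃! γ : L, γ • x ∈ F) (γ : G m) :
    ∃! δ : L, δ • γ ∈ orbitPreimage F := by
  have h := hFu (γ • origin m)
  have e : ∀ δ : L, δ • γ ∈ orbitPreimage F ↔ δ • γ • origin m ∈ F := fun δ => by
    change ((δ : G m) * γ) • origin m ∈ F ↔ (δ : G m) • γ • origin m ∈ F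
    rw [mul_smul]
  simpa only [e] using h

/-- Each right translate of the set of isometries that map the origin into a fundamental domain is
a fundamental domain for the left multiplication by the lattice. -/
lemma isFundamentalDomain_orbitPreimage (hF : MeasurableSet F)
    (hFu : ∀ x : Hyp m, ∃! γ : L, γ • x ∈ F) (g : G m) :
    IsFundamentalDomain L ((fun γ => γ * g) ⁻¹' orbitPreimage F) (Measure.haar : Measure (G m)) := by
  refine IsFundamentalDomain.mk'
    ((measurable_mul_const g) (measurableSet_orbitPreimage hF)).nullMeasurableSet fun γ => ?_
  have h := existsUnique_smul_mem_orbitPreimage hFu (γ * g)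
  have e : ∀ δ : L, δ • γ ∈ (fun γ => γ * g) ⁻¹' orbitPreimage F ↔
      δ • (γ * g) ∈ orbitPreimage F := fun δ => by
    change (δ : G m) * γ * g ∈ orbitPreimage F ↔ (δ : G m) * (γ * g) ∈ orbitPreimage F
    rw [mul_assoc]
  simpa only [e] using h

lemma isFundamentalDomain_orbitPreimage' (hF : MeasurableSet F)
    (hFu : ∀ x : Hyp m, ∃! γ : L, γ • x ∈ F) :
    IsFundamentalDomain L (orbitPreimage F) (Measure.haar : Measure (G m)) := by
  simpa using isFundamentalDomain_orbitPreimage hF hFu 1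

lemma haar_orbitPreimage_pos [Countable L] (hF : MeasurableSet F)
    (hFu : ∀ x : Hyp m, ∃! γ : L, γ • x ∈ F) : 0 < Measure.haar (orbitPreimage F) := by
  refine pos_iff_ne_zero.2 fun h0 => ?_
  refine (isOpen_univ.measure_pos (Measure.haar : Measure (G m)) univ_nonempty).ne'
    ((isFundamentalDomain_orbitPreimage' hF hFu).measure_zero_of_invariant univ
      (fun γ => smul_set_univ) ?_)
  rwa [univ_inter]

/-- The group is unimodular: a right translation multiplies the Haar measure by a scalar and
preserves the positive and finite measure of a fundamental domain of the lattice. -/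
lemma IsUniformLattice.isMulRightInvariant_haar (hL : IsUniformLattice L) :
    (Measure.haar : Measure (G m)).IsMulRightInvariant := by
  have := hL.countable
  obtain ⟨F, hF, ⟨K, hK, hFK⟩, hFu⟩ := hL.exists_fundamentalDomain
  refine ⟨fun g => ?_⟩
  have h := Measure.map_right_mul_eq_modularCharacterFun_smul (Measure.haar : Measure (G m)) g
  have h1 := congrArg (fun μ : Measure (G m) => μ (orbitPreimage F)) h
  simp only [Measure.map_apply (measurable_mul_const g) (measurableSet_orbitPreimage hF)] at h1
  rw [(isFundamentalDomain_orbitPreimage hF hFu g).measure_eq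
    (isFundamentalDomain_orbitPreimage' hF hFu), Measure.smul_apply, ENNReal.smul_def,
    smul_eq_mul] at h1
  have h2 : (Measure.modularCharacterFun g : ℝ≥0∞) = 1 := by
    refine (ENNReal.mul_left_inj (haar_orbitPreimage_pos hF hFu).ne'
      (haar_orbitPreimage_lt_top hK hFK).ne).1 ?_
    rw [← h1, one_mul]
  rw [h, ENNReal.coe_eq_one.1 h2, one_smul]

/-- The image of a bi-invariant Haar measure under `γ ↦ γ.𝒪` is proportional to the hyperbolic
volume: both sides are the integral of `1_C(γ.𝒪) 1_A(γ.x)` over `γ` and `x`. The second side is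
obtained by replacing `γ` by `γ b⁻¹`, where `b` is the boost from `𝒪` to `x`: it moves `x` to `𝒪` and
`𝒪` to the mirror image of `x`, and the volume is invariant under the reflection in `𝒪`. -/
lemma hvol_mul_haar_comm [(Measure.haar : Measure (G m)).IsMulRightInvariant]
    {A C : Set (Hyp m)} (hA : MeasurableSet A) (hC : MeasurableSet C) :
    hvol m A * Measure.haar (orbitPreimage C) = hvol m C * Measure.haar (orbitPreimage A) := by
  have hmA : Measurable (A.indicator 1 : Hyp m → ℝ≥0∞) := measurable_one.indicator hA
  have hmC : Measurable (C.indicator 1 : Hyp m → ℝ≥0∞) := measurable_one.indicator hC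
  have hoA : Measurable fun γ : G m => (A.indicator 1 (γ • origin m) : ℝ≥0∞) :=
    hmA.comp continuous_smul_origin.measurable
  have hoC : Measurable fun γ : G m => (C.indicator 1 (γ • origin m) : ℝ≥0∞) :=
    hmC.comp continuous_smul_origin.measurable
  have hsmul : Measurable fun p : G m × Hyp m => p.1 • p.2 := continuous_smul.measurable
  have hind : ∀ (B : Set (Hyp m)), MeasurableSet B →
      ∫⁻ γ : G m, B.indicator 1 (γ • origin m) ∂Measure.haar =
        Measure.haar (orbitPreimage B) := fun B hB => by
    rw [← lintegral_indicator_one (measurableSet_orbitPreimage hB)]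
    rfl
  have hinv : ∀ (B : Set (Hyp m)), MeasurableSet B → ∀ γ : G m,
      ∫⁻ x, B.indicator 1 (γ • x) ∂hvol m = hvol m B := fun B hB γ => by
    rw [(measurePreserving_smul γ (hvol m)).lintegral_comp (measurable_one.indicator hB),
      lintegral_indicator_one hB]
  calc hvol m A * Measure.haar (orbitPreimage C)
      = ∫⁻ γ : G m, ∫⁻ x, C.indicator 1 (γ • origin m) * A.indicator 1 (γ • x) ∂hvol m
          ∂Measure.haar := by
        rw [← hind C hC, ← lintegral_const_mul _ hoC]
        refine lintegral_congr fun γ => ?_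
        have hγ : Measurable fun x => (A.indicator 1 (γ • x) : ℝ≥0∞) :=
          hmA.comp (measurable_const_smul γ)
        rw [lintegral_const_mul _ hγ, hinv A hA, mul_comm]
    _ = ∫⁻ x, ∫⁻ γ : G m, C.indicator 1 (γ • origin m) * A.indicator 1 (γ • x) ∂Measure.haar
          ∂hvol m := by
        refine lintegral_lintegral_swap (Measurable.aemeasurable ?_)
        exact (hoC.comp measurable_fst).mul
          (hmA.comp hsmul)
    _ = ∫⁻ x, ∫⁻ γ : G m, C.indicator 1 (γ • pointRefl x) * A.indicator 1 (γ • origin m)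
          ∂Measure.haar ∂hvol m := by
        refine lintegral_congr fun x => ?_
        rw [← lintegral_mul_right_eq_self _ (boost x)⁻¹]
        refine lintegral_congr fun γ => ?_
        rw [mul_smul, mul_smul, boost_inv_smul_origin,
          show (boost x)⁻¹ • x = origin m by rw [inv_smul_eq_iff, boost_smul_origin]]
    _ = ∫⁻ γ : G m, ∫⁻ x, C.indicator 1 (γ • pointRefl x) * A.indicator 1 (γ • origin m)
          ∂hvol m ∂Measure.haar := by
        refine (lintegral_lintegral_swap (Measurable.aemeasurable ?_)).symm
        exact (hmC.comp (hsmul.comp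
          (measurable_fst.prodMk (continuous_pointRefl.measurable.comp measurable_snd)))).mul
          (hoA.comp measurable_fst)
    _ = hvol m C * Measure.haar (orbitPreimage A) := by
        rw [← hind A hA, ← lintegral_const_mul _ hoA]
        refine lintegral_congr fun γ => ?_
        have hγ : Measurable fun x => (C.indicator 1 (γ • x) : ℝ≥0∞) :=
          hmC.comp (measurable_const_smul γ)
        have hγ' : Measurable fun x => (C.indicator 1 (γ • pointRefl x) : ℝ≥0∞) :=
          hγ.comp continuous_pointRefl.measurable
        rw [lintegral_mul_const _ hγ',
          measurePreserving_pointRefl.lintegral_comp hγ, hinv C hC]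

/-! ### The invariant measure on the cosets of the lattice -/

/-- The distribution of `γ⁻¹ L` where `γ` is a Haar random isometry that maps the origin into
`F`. -/
def cosetMeasure (L : Subgroup (G m)) (F : Set (Hyp m)) : Measure (G m ⧸ L) :=
  (Measure.haar (orbitPreimage F))⁻¹ •
    Measure.map (fun γ : G m => (QuotientGroup.mk γ⁻¹ : G m ⧸ L))
      (Measure.haar.restrict (orbitPreimage F))

lemma measurable_mk : Measurable (QuotientGroup.mk : G m → G m ⧸ L) := measurable_quot_mk

lemma measurableSet_coset_iff {E : Set (G m ⧸ L)} :
    MeasurableSet E ↔ MeasurableSet ((QuotientGroup.mk : G m → G m ⧸ L) ⁻¹' E) := Iff.rfl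

lemma measurable_mk_inv : Measurable fun γ : G m => (QuotientGroup.mk γ⁻¹ : G m ⧸ L) :=
  measurable_mk.comp measurable_inv

lemma cosetMeasure_apply {E : Set (G m ⧸ L)} (hE : MeasurableSet E) :
    cosetMeasure L F E = (Measure.haar (orbitPreimage F))⁻¹ *
      Measure.haar ({γ : G m | (QuotientGroup.mk γ⁻¹ : G m ⧸ L) ∈ E} ∩ orbitPreimage F) := by
  rw [cosetMeasure, Measure.smul_apply, smul_eq_mul, Measure.map_apply measurable_mk_inv hE,
    Measure.restrict_apply (measurable_mk_inv hE)]
  rfl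

lemma mk_inv_smul (δ : L) (γ : G m) :
    (QuotientGroup.mk (δ • γ)⁻¹ : G m ⧸ L) = QuotientGroup.mk γ⁻¹ := by
  change (QuotientGroup.mk ((δ : G m) * γ)⁻¹ : G m ⧸ L) = _
  rw [_root_.mul_inv_rev]
  exact QuotientGroup.mk_mul_of_mem _ (L.inv_mem δ.2)

lemma isProbabilityMeasure_cosetMeasure [Countable L] (hF : MeasurableSet F) {K : Set (Hyp m)}
    (hK : IsCompact K) (hFK : F ⊆ K) (hFu : ∀ x : Hyp m, ∃! γ : L, γ • x ∈ F) :
    IsProbabilityMeasure (cosetMeasure L F) := by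
  refine ⟨?_⟩
  rw [cosetMeasure_apply MeasurableSet.univ]
  simp only [mem_univ, ofPred_true, univ_inter]
  exact ENNReal.inv_mul_cancel (haar_orbitPreimage_pos hF hFu).ne'
    (haar_orbitPreimage_lt_top hK hFK).ne

lemma smulInvariantMeasure_cosetMeasure [Countable L]
    [(Measure.haar : Measure (G m)).IsMulRightInvariant] (hF : MeasurableSet F)
    (hFu : ∀ x : Hyp m, ∃! γ : L, γ • x ∈ F) :
    SMulInvariantMeasure (G m) (G m ⧸ L) (cosetMeasure L F) := by
  refine ⟨fun g E hE => ?_⟩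
  have hgE : MeasurableSet ((fun q : G m ⧸ L => g • q) ⁻¹' E) :=
    measurableSet_coset_iff.2 ((measurable_const_mul g) (measurableSet_coset_iff.1 hE))
  rw [cosetMeasure_apply hE, cosetMeasure_apply hgE]
  congr 1
  have h1 : {γ : G m | (QuotientGroup.mk γ⁻¹ : G m ⧸ L) ∈ (fun q : G m ⧸ L => g • q) ⁻¹' E} ∩
      orbitPreimage F = (fun γ => γ * g⁻¹) ⁻¹' ({γ : G m | (QuotientGroup.mk γ⁻¹ : G m ⧸ L) ∈ E} ∩
        (fun γ => γ * g) ⁻¹' orbitPreimage F) := by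
    ext γ
    simp only [mem_inter_iff, mem_preimage, mem_ofPred_eq, inv_mul_cancel_right, _root_.mul_inv_rev,
      inv_inv]
    rfl
  rw [h1, measure_preimage_mul_right]
  refine (isFundamentalDomain_orbitPreimage hF hFu g).measure_set_eq
    (isFundamentalDomain_orbitPreimage' hF hFu) (measurable_mk_inv hE) fun δ => ?_
  ext γ
  simp only [mem_preimage, mem_ofPred_eq, mk_inv_smul]

lemma haar_eq_zero_of_cosetMeasure_eq_zero [Countable L] (hF : MeasurableSet F) {K : Set (Hyp m)}
    (hK : IsCompact K) (hFK : F ⊆ K) (hFu : ∀ x : Hyp m, ∃! γ : L, γ • x ∈ F)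
    {N : Set (G m ⧸ L)} (hN : MeasurableSet N) (h0 : cosetMeasure L F N = 0) :
    Measure.haar {γ : G m | (QuotientGroup.mk γ⁻¹ : G m ⧸ L) ∈ N} = 0 := by
  rw [cosetMeasure_apply hN, mul_eq_zero, ENNReal.inv_eq_zero] at h0
  refine (isFundamentalDomain_orbitPreimage' hF hFu).measure_zero_of_invariant _ (fun δ => ?_)
    (h0.resolve_left (haar_orbitPreimage_lt_top hK hFK).ne)
  ext γ
  rw [mem_smul_set_iff_inv_smul_mem, mem_ofPred_eq, mem_ofPred_eq, mk_inv_smul]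

/-- The coset measure lies over the normalised volume of `ℍ^m / L` under `γ L ↦ L γ⁻¹ 𝒪`. -/
lemma IsUniformLattice.cosetMeasure_eq (hL : IsUniformLattice L) (hF : MeasurableSet F)
    {K : Set (Hyp m)} (hK : IsCompact K) (hFK : F ⊆ K) (hFu : ∀ x : Hyp m, ∃! γ : L, γ • x ∈ F)
    {E : Set (G m ⧸ L)} (hE : MeasurableSet E) {D : Set (QuotSpace L)} (hD : MeasurableSet D)
    (hED : ∀ γ : G m, (QuotientGroup.mk γ⁻¹ : G m ⧸ L) ∈ E ↔ proj L (γ • origin m) ∈ D) :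
    cosetMeasure L F E = qvol L D / qvol L univ := by
  have := hL.countable
  have := hL.isMulRightInvariant_haar
  have hDF : MeasurableSet (proj L ⁻¹' D ∩ F) := (measurable_proj hD).inter hF
  have hset : {γ : G m | (QuotientGroup.mk γ⁻¹ : G m ⧸ L) ∈ E} ∩ orbitPreimage F =
      orbitPreimage (proj L ⁻¹' D ∩ F) := by
    ext γ
    simp only [mem_inter_iff, mem_ofPred_eq, hED]
    rfl
  rw [cosetMeasure_apply hE, hset, hL.qvol_apply hF hFu hD,
    hL.qvol_apply hF hFu MeasurableSet.univ, preimage_univ, univ_inter]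
  have hcomm := hvol_mul_haar_comm hF hDF
  have h1 := (hL.hvol_fundamentalDomain_pos hF hFu).ne'
  have h2 : hvol m F ≠ ⊤ := ((measure_mono hFK).trans_lt hK.measure_lt_top).ne
  rw [ENNReal.eq_div_iff h1 h2, mul_left_comm, hcomm, ← mul_assoc, mul_comm _ (hvol m _),
    mul_assoc, ENNReal.inv_mul_cancel (haar_orbitPreimage_pos hF hFu).ne'
    (haar_orbitPreimage_lt_top hK hFK).ne, mul_one]

variable {R : ℝ}

/-! ### The action on the space of packings -/

lemma smul_pts (γ : G m) (X : S m R) : (γ • X).pts = (fun x => γ • x) '' X.pts := rfl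

lemma smul_pts_inter_nonempty_iff (γ : G m) (X : S m R) (U : Set (Hyp m)) :
    ((γ • X).pts ∩ U).Nonempty ↔ (X.pts ∩ (fun x => γ • x) ⁻¹' U).Nonempty := by
  rw [smul_pts, image_inter_nonempty_iff]

lemma smul_pts_inter_eq_empty_iff (γ : G m) (X : S m R) (K : Set (Hyp m)) :
    (γ • X).pts ∩ K = ∅ ↔ X.pts ∩ (fun x => γ • x) ⁻¹' K = ∅ := by
  rw [← not_nonempty_iff_eq_empty, ← not_nonempty_iff_eq_empty, smul_pts_inter_nonempty_iff]

lemma isOpen_hit {U : Set (Hyp m)} (hU : IsOpen U) :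
    IsOpen {X : S m R | (X.pts ∩ U).Nonempty} :=
  TopologicalSpace.isOpen_generateFrom_of_mem (Or.inl ⟨U, hU, rfl⟩)

lemma isOpen_miss {K : Set (Hyp m)} (hK : IsCompact K) :
    IsOpen {X : S m R | X.pts ∩ K = ∅} :=
  TopologicalSpace.isOpen_generateFrom_of_mem (Or.inr ⟨K, hK, rfl⟩)

instance : ContinuousConstSMul (G m) (S m R) := by
  refine ⟨fun γ => continuous_generateFrom_iff.2 ?_⟩
  rintro _ (⟨U, hU, rfl⟩ | ⟨K, hK, rfl⟩)
  · simp only [preimage_ofPred_eq, smul_pts_inter_nonempty_iff]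
    exact isOpen_hit (hU.preimage (continuous_const_smul γ))
  · simp only [preimage_ofPred_eq, smul_pts_inter_eq_empty_iff]
    exact isOpen_miss ((Homeomorph.smul γ).isCompact_preimage.2 hK)

/-- The orbit maps of the space of packings are continuous. -/
lemma S.continuous_smul_const (hR : 0 < R) (X : S m R) : Continuous fun γ : G m => γ • X := by
  refine continuous_generateFrom_iff.2 ?_
  rintro _ (⟨U, hU, rfl⟩ | ⟨K, hK, rfl⟩)
  · have : (fun γ : G m => γ • X) ⁻¹' {X | (X.pts ∩ U).Nonempty} =
        ⋃ x ∈ X.pts, {γ : G m | γ • x ∈ U} := by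
      ext γ
      rw [mem_preimage, mem_ofPred_eq, smul_pts_inter_nonempty_iff]
      simp [Set.Nonempty]
    rw [this]
    exact isOpen_biUnion fun x _ => hU.preimage (continuous_id.smul continuous_const)
  · have := isCompact_iff_compactSpace.1 hK
    -- the projection along the compact set `K` is a closed map
    have hcl : IsClosed {p : G m × K | p.1⁻¹ • (p.2 : Hyp m) ∈ X.pts} :=
      (X.isPacking.isClosed hR).preimage
        (continuous_fst.inv.smul (continuous_subtype_val.comp continuous_snd))
    have : (fun γ : G m => γ • X) ⁻¹' {X | X.pts ∩ K = ∅} =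
        (Prod.fst '' {p : G m × K | p.1⁻¹ • (p.2 : Hyp m) ∈ X.pts})ᶜ := by
      ext γ
      rw [mem_preimage, mem_ofPred_eq, smul_pts_inter_eq_empty_iff, ← not_nonempty_iff_eq_empty,
        mem_compl_iff, not_iff_not]
      constructor
      · rintro ⟨x, hx, hxK⟩
        exact ⟨(γ, ⟨γ • x, hxK⟩), by simpa using hx, rfl⟩
      · rintro ⟨⟨δ, k⟩, hk, rfl⟩
        exact ⟨_, hk, by simp⟩
    rw [this]
    exact (isClosedMap_fst_of_compactSpace _ hcl).isOpen_compl

lemma measurableSet_origin_mem_ballUnion :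
    MeasurableSet {X : S m R | origin m ∈ ballUnion hdist R X.pts} := by
  have : {X : S m R | origin m ∈ ballUnion hdist R X.pts} =
      {X : S m R | X.pts ∩ {y | hdist (origin m) y ≤ R} = ∅}ᶜ := by
    ext X
    rw [mem_compl_iff, mem_ofPred_eq, mem_ofPred_eq, ← not_nonempty_iff_eq_empty, not_not]
    constructor <;> rintro ⟨x, hx, h⟩
    · exact ⟨x, hx, by rwa [mem_ofPred_eq, hdist_comm]⟩
    · exact ⟨x, hx, by rwa [mem_ofPred_eq, hdist_comm] at h⟩
  rw [this]
  exact (isOpen_miss (isCompact_hclosedBall _ _)).measurableSet.compl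

lemma avgDensity_eq (μ : Measure (S m R)) :
    avgDensity μ = μ {X : S m R | origin m ∈ ballUnion hdist R X.pts} :=
  lintegral_indicator_one measurableSet_origin_mem_ballUnion

lemma image_smul_eq_preimage (γ : G m) (E : Set (S m R)) :
    (fun X => γ • X) '' E = (fun X => γ⁻¹ • X) ⁻¹' E := by
  rw [preimage_smul, inv_inv, image_smul]

lemma measurePreserving_of_mem_invMeasures {μ : Measure (S m R)} (hμ : μ ∈ invMeasures m R)
    (γ : G m) : MeasurePreserving (fun X => γ • X) μ μ := by
  refine ⟨measurable_const_smul γ, Measure.ext fun E hE => ?_⟩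
  rw [Measure.map_apply (measurable_const_smul γ) hE]
  have h := hμ.2 γ⁻¹ E hE
  rwa [image_smul_eq_preimage, inv_inv] at h

/-! ### Random translates of a periodic packing -/

section Translates

variable {X : S m R} {f : G m ⧸ L → S m R}

lemma measurable_of_orbit (hR : 0 < R) (hf : ∀ γ : G m, f (QuotientGroup.mk γ) = γ • X) :
    Measurable f := by
  intro E hE
  refine measurableSet_coset_iff.2 ?_
  have : (QuotientGroup.mk : G m → G m ⧸ L) ⁻¹' (f ⁻¹' E) = (fun γ : G m => γ • X) ⁻¹' E := by
    ext γ
    simp only [mem_preimage, hf]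
  rw [this]
  exact (S.continuous_smul_const hR X).measurable hE

lemma map_smul_of_orbit (hf : ∀ γ : G m, f (QuotientGroup.mk γ) = γ • X) (g : G m)
    (q : G m ⧸ L) : f (g • q) = g • f q := by
  induction q using QuotientGroup.induction_on with
  | H γ =>
    rw [hf, ← mul_smul, ← hf]
    rfl

lemma map_mem_invMeasures (hR : 0 < R) (hf : ∀ γ : G m, f (QuotientGroup.mk γ) = γ • X)
    (ν : Measure (G m ⧸ L)) [IsProbabilityMeasure ν] [SMulInvariantMeasure (G m) (G m ⧸ L) ν] :
    Measure.map f ν ∈ invMeasures m R := by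
  have hfm := measurable_of_orbit hR hf
  refine ⟨Measure.isProbabilityMeasure_map hfm.aemeasurable, fun γ E hE => ?_⟩
  rw [image_smul_eq_preimage, Measure.map_apply hfm hE,
    Measure.map_apply hfm (measurable_const_smul γ⁻¹ hE)]
  have : f ⁻¹' ((fun X => γ⁻¹ • X) ⁻¹' E) = (fun q : G m ⧸ L => γ⁻¹ • q) ⁻¹' (f ⁻¹' E) := by
    ext q
    simp only [mem_preimage, map_smul_of_orbit hf]
  rw [this]
  exact SMulInvariantMeasure.measure_preimage_smul γ⁻¹ (hfm hE)

/-- On a unimodular group, a function that is almost invariant under each translation is almost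
constant, by Fubini's theorem. -/
lemma exists_ae_eq_const_of_ae_eq_mul {Γ : Type*} [Group Γ] [MeasurableSpace Γ]
    [MeasurableMul₂ Γ] [MeasurableInv Γ] (μ : Measure Γ) [SigmaFinite μ] [NeZero μ]
    [μ.IsMulLeftInvariant] [μ.IsMulRightInvariant] {H : Γ → ℝ≥0∞} (hH : Measurable H)
    (hinv : ∀ γ, ∀ᵐ δ ∂μ, H (γ * δ⁻¹) = H δ⁻¹) : ∃ c, ∀ᵐ γ ∂μ, H γ⁻¹ = c := by
  have h2 : ∀ᵐ δ ∂μ, ∀ᵐ γ ∂μ, H (γ * δ⁻¹) = H δ⁻¹ := by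
    refine (Measure.ae_ae_comm ?_).1 (Filter.Eventually.of_forall hinv)
    exact measurableSet_eq_fun (hH.comp (measurable_fst.mul measurable_snd.inv))
      (hH.comp measurable_snd.inv)
  obtain ⟨δ, hδ⟩ := h2.exists
  refine ⟨H δ⁻¹, ?_⟩
  have h3 : ∀ᵐ γ ∂μ, H γ = H δ⁻¹ := by
    have := (measurePreserving_mul_right μ δ).quasiMeasurePreserving.ae hδ
    simpa only [mul_inv_cancel_right] using this
  exact (quasiMeasurePreserving_inv μ).ae h3

/-- A function of packings that is almost invariant under each isometry is almost constant. -/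
lemma exists_ae_eq_const_of_ae_invariant [Countable L]
    [(Measure.haar : Measure (G m)).IsMulRightInvariant] (hR : 0 < R) {F K : Set (Hyp m)}
    (hF : MeasurableSet F) (hK : IsCompact K) (hFK : F ⊆ K)
    (hFu : ∀ x : Hyp m, ∃! γ : L, γ • x ∈ F)
    (hf : ∀ γ : G m, f (QuotientGroup.mk γ) = γ • X) {h : S m R → ℝ≥0∞} (hh : Measurable h)
    (hinv : ∀ γ : G m, (fun Z => h (γ • Z)) =ᵐ[Measure.map f (cosetMeasure L F)] h) :
    ∃ c : ℝ≥0∞, h =ᵐ[Measure.map f (cosetMeasure L F)] fun _ => c := by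
  have hfm := measurable_of_orbit hR hf
  have hH : Measurable fun γ : G m => h (γ • X) :=
    hh.comp (S.continuous_smul_const hR X).measurable
  have h1 : ∀ γ : G m, ∀ᵐ δ : G m ∂Measure.haar, h ((γ * δ⁻¹) • X) = h (δ⁻¹ • X) := by
    intro γ
    have hN : MeasurableSet {Z : S m R | h (γ • Z) ≠ h Z} :=
      (measurableSet_eq_fun (hh.comp (measurable_const_smul γ)) hh).compl
    have h2 := ae_iff.1 (hinv γ)
    change Measure.map f (cosetMeasure L F) {Z : S m R | h (γ • Z) ≠ h Z} = 0 at h2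
    rw [Measure.map_apply hfm hN] at h2
    have h3 := haar_eq_zero_of_cosetMeasure_eq_zero hF hK hFK hFu (hfm hN) h2
    refine measure_mono_null (fun δ hδ => ?_) h3
    change h (γ • f (QuotientGroup.mk δ⁻¹)) ≠ h (f (QuotientGroup.mk δ⁻¹))
    rw [hf, ← mul_smul]
    exact hδ
  obtain ⟨c, hc⟩ := exists_ae_eq_const_of_ae_eq_mul Measure.haar hH h1
  refine ⟨c, ae_iff.2 ?_⟩
  have hN : MeasurableSet {Z : S m R | h Z ≠ c} := (measurableSet_eq_fun hh measurable_const).compl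
  change Measure.map f (cosetMeasure L F) {Z : S m R | h Z ≠ c} = 0
  rw [Measure.map_apply hfm hN, cosetMeasure_apply (hfm hN)]
  refine mul_eq_zero_of_right _ (measure_mono_null inter_subset_left
    (measure_mono_null (fun γ hγ => ?_) (ae_iff.1 hc)))
  change h (f (QuotientGroup.mk γ⁻¹)) ≠ c at hγ
  rw [hf] at hγ
  exact hγ

lemma map_cosetMeasure_mem_ergMeasures [Countable L]
    [(Measure.haar : Measure (G m)).IsMulRightInvariant] (hR : 0 < R) {F K : Set (Hyp m)}
    (hF : MeasurableSet F) (hK : IsCompact K) (hFK : F ⊆ K)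
    (hFu : ∀ x : Hyp m, ∃! γ : L, γ • x ∈ F)
    (hf : ∀ γ : G m, f (QuotientGroup.mk γ) = γ • X) :
    Measure.map f (cosetMeasure L F) ∈ ergMeasures m R := by
  have := isProbabilityMeasure_cosetMeasure hF hK hFK hFu
  have := smulInvariantMeasure_cosetMeasure hF hFu
  have hμ := map_mem_invMeasures hR hf (cosetMeasure L F)
  refine ⟨hμ, ?_⟩
  rintro μ₁ hμ₁ μ₂ - ⟨a, b, ha, -, -, hab⟩
  have := hμ.1
  have := hμ₁.1
  have hac : μ₁ ≪ Measure.map f (cosetMeasure L F) := by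
    refine Measure.AbsolutelyContinuous.mk fun E _ h0 => ?_
    rw [← hab, Measure.add_apply, add_eq_zero, Measure.smul_apply, ENNReal.smul_def, smul_eq_mul,
      mul_eq_zero] at h0
    exact h0.1.resolve_left (by simpa using ha.ne')
  set μ := Measure.map f (cosetMeasure L F) with hμdef
  have hh : Measurable (μ₁.rnDeriv μ) := Measure.measurable_rnDeriv _ _
  have hwd : μ.withDensity (μ₁.rnDeriv μ) = μ₁ := Measure.withDensity_rnDeriv_eq _ _ hac
  have hset : ∀ E, MeasurableSet E → ∫⁻ Z in E, μ₁.rnDeriv μ Z ∂μ = μ₁ E := fun E hE => by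
    rw [← withDensity_apply _ hE, hwd]
  have hinv : ∀ γ : G m, (fun Z => μ₁.rnDeriv μ (γ • Z)) =ᵐ[μ] μ₁.rnDeriv μ := by
    intro γ
    refine ae_eq_of_forall_setLIntegral_eq_of_sigmaFinite
      (hh.comp (measurable_const_smul γ)) hh fun E hE _ => ?_
    have hE' : MeasurableSet ((fun Z : S m R => γ⁻¹ • Z) ⁻¹' E) := measurable_const_smul γ⁻¹ hE
    have h1 := (measurePreserving_of_mem_invMeasures hμ γ).setLIntegral_comp_preimage hE' hh
    have h2 : (fun Z : S m R => γ • Z) ⁻¹' ((fun Z : S m R => γ⁻¹ • Z) ⁻¹' E) = E := by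
      ext Z
      simp
    rw [h2, hset _ hE', (measurePreserving_of_mem_invMeasures hμ₁ γ⁻¹).measure_preimage
      hE.nullMeasurableSet] at h1
    rw [h1, hset _ hE]
  obtain ⟨c, hc⟩ := exists_ae_eq_const_of_ae_invariant hR hF hK hFK hFu hf hh hinv
  have h1 : μ₁ = c • μ := by
    rw [← withDensity_const, ← withDensity_congr_ae hc, hwd]
  have h2 : c = 1 := by
    have h3 := congrArg (fun κ : Measure (S m R) => κ univ) h1
    simpa using h3.symm
  rw [h1, h2, one_smul]

end Translates

/-! ### Packings of the quotient -/

lemma avgDensity_map_cosetMeasure (hL : IsUniformLattice L) (hR : 0 < R)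
    {F K : Set (Hyp m)} (hF : MeasurableSet F) (hK : IsCompact K) (hFK : F ⊆ K)
    (hFu : ∀ x : Hyp m, ∃! γ : L, γ • x ∈ F) {Y : Set (QuotSpace L)} {X : S m R}
    (hX : X.pts = proj L ⁻¹' Y) {f : G m ⧸ L → S m R}
    (hf : ∀ γ : G m, f (QuotientGroup.mk γ) = γ • X) :
    avgDensity (Measure.map f (cosetMeasure L F)) = density (qdist L) (qvol L) R Y := by
  have hfm := measurable_of_orbit hR hf
  have hD : MeasurableSet (ballUnion (qdist L) R Y) := by
    change MeasurableSet (proj L ⁻¹' ballUnion (qdist L) R Y)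
    rw [← hL.ballUnion_preimage, ← hX]
    exact X.isPacking.measurableSet_ballUnion hR
  rw [avgDensity_eq, Measure.map_apply hfm measurableSet_origin_mem_ballUnion, density]
  refine hL.cosetMeasure_eq hF hK hFK hFu (hfm measurableSet_origin_mem_ballUnion) hD fun γ => ?_
  rw [← mem_preimage (f := proj L), ← hL.ballUnion_preimage, ← hX, mem_preimage, hf, mem_ofPred_eq,
    smul_pts]
  constructor
  · rintro ⟨_, ⟨x, hx, rfl⟩, h⟩
    refine ⟨x, hx, ?_⟩
    rwa [← hdist_smul γ⁻¹, inv_smul_smul]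
  · rintro ⟨x, hx, h⟩
    refine ⟨γ⁻¹ • x, ⟨x, hx, rfl⟩, ?_⟩
    rwa [← hdist_smul γ, smul_inv_smul]

lemma qdist_self (q : QuotSpace L) : qdist L q q ≤ 0 := by
  obtain ⟨x, rfl⟩ := proj_surjective q
  exact (qdist_le_hdist x x).trans (hdist_self x).le

/-- Every packing extends to a maximal one, which is relatively dense. -/
lemma IsPacking.exists_isRelDense (hR : 0 < R) {Y : Set (QuotSpace L)}
    (hY : IsPacking (qdist L) R Y) :
    ∃ Z, Y ⊆ Z ∧ IsPacking (qdist L) R Z ∧ IsRelDense (qdist L) R Z := by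
  have hchain : ∀ c ⊆ {Z | IsPacking (qdist L) R Z}, IsChain (· ⊆ ·) c → c.Nonempty →
      ∃ ub ∈ {Z | IsPacking (qdist L) R Z}, ∀ s ∈ c, s ⊆ ub := by
    refine fun c hc hchain _ => ⟨⋃₀ c, ?_, fun s hs => subset_sUnion_of_mem hs⟩
    rintro x ⟨s, hs, hxs⟩ y ⟨t, ht, hyt⟩ hxy
    rcases hchain.total hs ht with h | h
    · exact hc ht x (h hxs) y hyt hxy
    · exact hc hs x hxs y (h hyt) hxy
  obtain ⟨Z, hYZ, hZ⟩ := zorn_subset_nonempty _ hchain Y hY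
  refine ⟨Z, hYZ, hZ.prop, fun p => ?_⟩
  by_contra! hfar
  have hpZ : p ∉ Z := fun hp => by linarith [hfar p hp, qdist_self p]
  have hins : IsPacking (qdist L) R (insert p Z) := by
    rintro x (rfl | hx) y (rfl | hy) hxy
    · exact absurd rfl hxy
    · exact (hfar y hy).le
    · rw [qdist_comm]
      exact (hfar x hx).le
    · exact hZ.prop x hx y hy hxy
  exact hpZ (hZ.le_of_ge hins (subset_insert p Z) (mem_insert p Z))

lemma exists_orbit_map {Y : Set (QuotSpace L)} {X : S m R}
    (hX : X.pts = proj L ⁻¹' Y) :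
    ∃ f : G m ⧸ L → S m R, ∀ γ : G m, f (QuotientGroup.mk γ) = γ • X := by
  have hstab : ∀ δ : L, (δ : G m) • X = X := by
    intro δ
    refine S.ext ?_
    rw [smul_pts, hX]
    ext x
    constructor
    · rintro ⟨y, hy, rfl⟩
      rw [mem_preimage]
      have := proj_smul δ y
      change proj L (δ • y) ∈ Y
      rwa [this]
    · intro hx
      refine ⟨δ⁻¹ • x, ?_, smul_inv_smul δ x⟩
      rwa [mem_preimage, proj_smul]
  refine ⟨Quotient.lift (fun γ : G m => γ • X) fun γ δ h => ?_, fun γ => rfl⟩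
  have h1 := hstab ⟨γ⁻¹ * δ, QuotientGroup.leftRel_apply.1 h⟩
  simp only [mul_smul] at h1
  exact (inv_smul_eq_iff.1 h1).symm

end BowenRadin

end

theorem lemma4p2 (m : ℕ) (R : ℝ) (hR : 0 < R) (L : Subgroup (BowenRadin.G m))
    (hL : BowenRadin.IsUniformLattice L)
    (hg : ENNReal.ofReal (8 * R) ≤ BowenRadin.girth L) :
    (0 < BowenRadin.qvol L univ ∧ BowenRadin.qvol L univ < ⊤) ∧
    BowenRadin.packingDensity (BowenRadin.qdist L) (BowenRadin.qvol L) R ≤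
      BowenRadin.hypDensity m R ∧
    ∀ Y : Set (BowenRadin.QuotSpace L),
      BowenRadin.IsPacking (BowenRadin.qdist L) R Y →
      BowenRadin.IsRelDense (BowenRadin.qdist L) R Y →
      ∃ X : BowenRadin.S m R, X.pts = BowenRadin.proj L ⁻¹' Y ∧
        ∃ ν : Measure (BowenRadin.G m ⧸ L), IsProbabilityMeasure ν ∧
          SMulInvariantMeasure (BowenRadin.G m) (BowenRadin.G m ⧸ L) ν ∧
          ∃ f : BowenRadin.G m ⧸ L → BowenRadin.S m R,
            (∀ γ : BowenRadin.G m, f (QuotientGroup.mk γ) = γ • X) ∧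
            Measure.map f ν ∈ BowenRadin.invMeasures m R ∧
            BowenRadin.avgDensity (Measure.map f ν) =
              BowenRadin.density (BowenRadin.qdist L) (BowenRadin.qvol L) R Y := by
  open BowenRadin in
  have := hL.countable
  have := hL.isMulRightInvariant_haar
  obtain ⟨F, hF, ⟨K, hK, hFK⟩, hFu⟩ := hL.exists_fundamentalDomain
  have hlift : ∀ Y : Set (QuotSpace L), IsPacking (qdist L) R Y → IsRelDense (qdist L) R Y →
      ∃ X : S m R, X.pts = proj L ⁻¹' Y := fun Y hY hY' =>
    ⟨⟨proj L ⁻¹' Y, isPacking_preimage_of_le_girth hR hg hY, hL.isRelDense_preimage hY'⟩, rfl⟩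
  refine ⟨?_, ?_, fun Y hY hY' => ?_⟩
  · rw [hL.qvol_apply hF hFu MeasurableSet.univ, preimage_univ, univ_inter]
    exact ⟨hL.hvol_fundamentalDomain_pos hF hFu, (measure_mono hFK).trans_lt hK.measure_lt_top⟩
  · refine iSup₂_le fun Y hY => ?_
    obtain ⟨Z, hYZ, hZ, hZ'⟩ := IsPacking.exists_isRelDense hR hY
    obtain ⟨X, hX⟩ := hlift Z hZ hZ'
    obtain ⟨f, hf⟩ := exists_orbit_map hX
    have hsub : ballUnion (qdist L) R Y ⊆ ballUnion (qdist L) R Z :=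
      fun _ ⟨x, hx, h⟩ => ⟨x, hYZ hx, h⟩
    calc density (qdist L) (qvol L) R Y ≤ density (qdist L) (qvol L) R Z :=
          ENNReal.div_le_div_right (measure_mono hsub) _
      _ = avgDensity (Measure.map f (cosetMeasure L F)) :=
          (avgDensity_map_cosetMeasure hL hR hF hK hFK hFu hX hf).symm
      _ ≤ hypDensity m R :=
          le_iSup₂ (f := fun μ (_ : μ ∈ ergMeasures m R) => avgDensity μ) _
            (map_cosetMeasure_mem_ergMeasures hR hF hK hFK hFu hf)
  · obtain ⟨X, hX⟩ := hlift Y hY hY'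
    obtain ⟨f, hf⟩ := exists_orbit_map hX
    have h1 := isProbabilityMeasure_cosetMeasure hF hK hFK hFu
    have h2 := smulInvariantMeasure_cosetMeasure hF hFu
    exact ⟨X, hX, cosetMeasure L F, h1, h2, f, hf, map_mem_invMeasures hR hf _,
      avgDensity_map_cosetMeasure hL hR hF hK hFK hFu hX hf⟩
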